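/- Let $L$ be Lebesgue measure on $\mathbb C$ and let $$\mathcal E=\{u(z)=e^{-|z|^2/2}f(z)\;:\; f \text{ entire}\}\cap L^2(\mathbb C)$$ be the Bargmann--Fock space. For $u\in\mathcal E$ put $$M(u)=\int_{\mathbb C}|u|^2\,dL,\qquad \mathcal H(u)=\tfrac14\int_{\mathbb C}|u|^4\,dL,\qquad P(u)=\int_{\mathbb C}(|z|^2-1)|u(z)|^2\,dL(z)\in(-\infty,+\infty],$$ and $\mathcal G_\mu(u)=8\pi\mathcal H(u)+\mu P(u)$ for $\mu>0$. A global minimizer of $\mathcal G_\mu$ is a $u\in\mathcal E$ with $M(u)=1$ such that $\mathcal G_\mu(u)\le\mathcal G_\mu(v)$ for all $v\in\mathcal E$ with $M(v)=1$. **Theorem 1.3.** Let $\mu=\frac12$. A function $u:\mathbb C\to\mathbb C$ is a global minimizer of $\mathcal G_{1/2}$ if and only if there are $\gamma,\theta\in\mathbb R$ such that $u(z)=e^{i\gamma}w(e^{i\theta}z)$ for all $z\in\mathbb C$, where $w$ is one of the functions $$\phi_0(z)=\frac{1}{\sqrt\pi}e^{-\frac{|z|^2}{2}},\qquad \phi_1(z)=\frac{1}{\sqrt\pi}\,z\,e^{-\frac{|z|^2}{2}},$$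 $$\psi_b(z)=\frac{e^{-\frac12\left(\frac{b}{1+b^2}\right)^2}}{\sqrt{\pi(1+b^2)}}\left(z-\frac{b(2+b^2)}{1+b^2}\right)e^{\frac{b}{1+b^2}z-\frac{|z|^2}{2}},\qquad 0\le b<+\infty.$$ -/

import Mathlib

open MeasureTheory

noncomputable section

namespace LLL

/-- The Bargmann-Fock space: functions `u z = exp (-|z|^2 / 2) * f z` with `f` entire
that are square integrable for the Lebesgue measure on the complex plane. Its elements are
honest functions (their continuous representatives), so equality is pointwise equality. -/
def bargmannFock : Set (ℂ → ℂ) :=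
  {u | (∃ f : ℂ → ℂ, Differentiable ℂ f ∧
          ∀ z, u z = ((Real.exp (-‖z‖ ^ 2 / 2) : ℝ) : ℂ) * f z) ∧
        MemLp u 2 (volume : Measure ℂ)}

/-- The mass `M(u) = ∫ |u|^2`, finite on the Bargmann-Fock space. -/
def mass (u : ℂ → ℂ) : ℝ := ∫ z : ℂ, ‖u z‖ ^ 2

/-- The Hamiltonian `H(u) = (1/4) ∫ |u|^4`, finite on the Bargmann-Fock space. -/
def hamiltonian (u : ℂ → ℂ) : ℝ := (1 / 4) * ∫ z : ℂ, ‖u z‖ ^ 4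

open Classical in
/-- The angular momentum `P(u) = ∫ (|z|^2 - 1) |u(z)|^2`, with values in the extended reals.
For `u` square integrable the negative part of the integrand is integrable, so if the integrand
is not integrable then its integral is `+∞`. -/
def angularMomentum (u : ℂ → ℂ) : EReal :=
  if Integrable (fun z : ℂ => (‖z‖ ^ 2 - 1) * ‖u z‖ ^ 2) then
    ((∫ z : ℂ, (‖z‖ ^ 2 - 1) * ‖u z‖ ^ 2 : ℝ) : EReal)
  else ⊤

/-- The energy `G_μ(u) = 8 π H(u) + μ P(u)` for `μ > 0`. -/
def energy (μ : ℝ) (u : ℂ → ℂ) : EReal :=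
  ((8 * Real.pi * hamiltonian u : ℝ) : EReal) + (μ : EReal) * angularMomentum u

/-- The set of admissible functions: elements of the Bargmann-Fock space of unit mass. -/
def unitMass : Set (ℂ → ℂ) := {u | u ∈ bargmannFock ∧ mass u = 1}

/-- `u` is a global minimizer of `G_μ` among the elements of the Bargmann-Fock space of
unit mass. -/
def IsGlobalMinimizer (μ : ℝ) (u : ℂ → ℂ) : Prop :=
  u ∈ unitMass ∧ ∀ v ∈ unitMass, energy μ u ≤ energy μ v

/-- Phase rotation `u(z) ↦ e^{iγ} u(z)`. -/
def phaseRotation (γ : ℝ) (u : ℂ → ℂ) : ℂ → ℂ :=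
  fun z => Complex.exp (Complex.I * (γ : ℂ)) * u z

/-- Space rotation `u(z) ↦ u(e^{iθ} z)`. -/
def spaceRotation (θ : ℝ) (u : ℂ → ℂ) : ℂ → ℂ :=
  fun z => u (Complex.exp (Complex.I * (θ : ℂ)) * z)

/-- The Gaussian `φ₀`. -/
def phi0 : ℂ → ℂ := fun z =>
  ((1 / Real.sqrt Real.pi : ℝ) : ℂ) * ((Real.exp (-‖z‖ ^ 2 / 2) : ℝ) : ℂ)

/-- The first excited special Hermite function `φ₁`. -/
def phi1 : ℂ → ℂ := fun z =>
  ((1 / Real.sqrt Real.pi : ℝ) : ℂ) * z * ((Real.exp (-‖z‖ ^ 2 / 2) : ℝ) : ℂ)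

/-- The function `ψ_b`, used for `b ≥ 0`. -/
def psi (b : ℝ) : ℂ → ℂ := fun z =>
  ((Real.exp (-(1 / 2) * (b / (1 + b ^ 2)) ^ 2) / Real.sqrt (Real.pi * (1 + b ^ 2)) : ℝ) : ℂ) *
    (z - ((b * (2 + b ^ 2) / (1 + b ^ 2) : ℝ) : ℂ)) *
    Complex.exp (((b / (1 + b ^ 2) : ℝ) : ℂ) * z - ((‖z‖ ^ 2 / 2 : ℝ) : ℂ))

end LLL

end

/-! Write `u = e^{-|z|²/2} f` and pass to the variables `s = z + w`, `x = (z - w)/2` in the two-body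
function `u(z)u(w)`. Its modulus squared is `e^{-|s|²/2} e^{-2|x|²} |F_s(x)|²`, where `F_s(x) =
f(s/2 + x) f(s/2 - x)` is entire and even in `x`. Mass, second moment and quartic energy all become
integrals over `s` of quadratic forms in `F_s`: the quartic energy sees only `F_s(0)`. For unit mass
and finite second moment this gives `G_{1/2}(u) = 1 + |Q|²/2 + ∫ e^{-|s|²/2} fiberDefect(F_s) ds`,
with `Q = ∫ z|u|²` (`hasIntegral_fiberDefect`, `energy_half_eq`).

The fibre form is diagonal in the monomials `x^n`, with eigenvalue proportional to `n - 2` for `n ≥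
1`, while at `n = 0` the quartic term lifts it exactly to zero (`hasSum_fiberDefect`). Evenness
removes the only negative mode `n = 1`. Hence the minimum is 1, attained exactly when `Q = 0` and
every `F_s` lies in the span of `1` and `x²`.

This last condition is a functional equation for `f`, whose nonzero entire solutions are `(pz +
q)e^{βz}` (`eq_affine_mul_exp_of_fiber`). Explicit Gaussian moments turn `M = 1` and `Q = 0` into
equations for `p, q, β`, whose solutions are the listed functions up to the two rotations. -/

noncomputable section

namespace LLL

/-! ### Parseval identities for radial weights, and Gaussian moments. -/

/-- Parseval's identity on the circle `{e^{iθ} y}` for a power series converging there. -/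
theorem hasSum_sq_norm_circle {b : ℕ → ℂ} {g : ℂ → ℂ}
    (hg : ∀ y, HasSum (fun n => b n * y ^ n) (g y)) (hc : Continuous g) (y : ℂ) :
    HasSum (fun n => 2 * Real.pi * (‖b n‖ ^ 2 * ‖y‖ ^ (2 * n)))
      (∫ θ in (0 : ℝ)..(2 * Real.pi), ‖g (Complex.exp (θ * Complex.I) * y)‖ ^ 2) := by
  have hexp : ∀ (n : ℕ) (θ : ℝ), ‖Complex.exp (n * θ * Complex.I)‖ = 1 := fun n θ => by
    have := Complex.norm_exp_ofReal_mul_I (n * θ)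
    push_cast at this
    exact this
  -- Termwise integration against a bounded weight serves twice: against conjugate exponentials it
  -- extracts the coefficients, against the conjugate of `g` it gives Parseval.
  have key : ∀ (G : ℝ → ℂ) (C : ℝ), Continuous G → (∀ θ, ‖G θ‖ ≤ C) →
      HasSum (fun n : ℕ => ∫ θ in (0 : ℝ)..(2 * Real.pi),
          b n * y ^ n * Complex.exp (n * θ * Complex.I) * G θ)
        (∫ θ in (0 : ℝ)..(2 * Real.pi), g (Complex.exp (θ * Complex.I) * y) * G θ) := by
    intro G C hG hC
    have hs : Summable (fun n => ‖b n * y ^ n‖) := (hg y).summable.norm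
    refine intervalIntegral.hasSum_integral_of_dominated_convergence
      (fun n _ => ‖b n * y ^ n‖ * C) (fun n => ?_) (fun n => ?_) ?_ ?_ ?_
    · exact (by fun_prop : Continuous _).aestronglyMeasurable
    · refine Filter.Eventually.of_forall fun θ _ => ?_
      rw [norm_mul, norm_mul]
      rw [hexp, mul_one]
      exact mul_le_mul_of_nonneg_left (hC θ) (norm_nonneg _)
    · exact Filter.Eventually.of_forall fun θ _ => hs.mul_right C
    · exact intervalIntegrable_const
    · refine Filter.Eventually.of_forall fun θ _ => ?_
      refine HasSum.mul_right (G θ) ?_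
      have := hg (Complex.exp (θ * Complex.I) * y)
      refine this.congr_fun fun n => ?_
      rw [mul_pow, ← Complex.exp_nat_mul]
      ring_nf
  have hcoef : ∀ m : ℕ, ∫ θ in (0 : ℝ)..(2 * Real.pi),
      g (Complex.exp (θ * Complex.I) * y) * (starRingEnd ℂ) (Complex.exp (m * θ * Complex.I)) =
        2 * Real.pi * (b m * y ^ m) := by
    intro m
    refine (key _ 1 (by fun_prop) fun θ => by rw [RCLike.norm_conj, hexp]).unique ?_
    have : ∀ n : ℕ, n ≠ m → ∫ θ in (0 : ℝ)..(2 * Real.pi),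
        b n * y ^ n * Complex.exp (n * θ * Complex.I) *
          (starRingEnd ℂ) (Complex.exp (m * θ * Complex.I)) = 0 := by
      intro n hn
      have hnm : ((n : ℂ) - m) * Complex.I ≠ 0 :=
        mul_ne_zero (sub_ne_zero.2 (by exact_mod_cast hn)) Complex.I_ne_zero
      calc _ = ∫ θ in (0 : ℝ)..(2 * Real.pi),
            b n * y ^ n * Complex.exp (((n : ℂ) - m) * Complex.I * θ) := by
            congr 1; ext θ
            rw [← Complex.exp_conj, mul_assoc, ← Complex.exp_add]
            simp only [map_mul, Complex.conj_ofReal, Complex.conj_I, Complex.conj_natCast]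
            ring_nf
        _ = 0 := by
            rw [intervalIntegral.integral_const_mul, integral_exp_mul_complex hnm]
            have : ((n : ℂ) - m) * Complex.I * ((2 * Real.pi : ℝ) : ℂ) =
                ((n - m : ℤ) : ℂ) * (2 * Real.pi * Complex.I) := by push_cast; ring
            rw [this, Complex.exp_int_mul_two_pi_mul_I]
            simp
    convert hasSum_single m this using 1
    have : ∀ θ : ℝ, b m * y ^ m * Complex.exp (m * θ * Complex.I) *
        (starRingEnd ℂ) (Complex.exp (m * θ * Complex.I)) = b m * y ^ m := fun θ => by
      rw [mul_assoc, Complex.mul_conj, Complex.normSq_eq_norm_sq, hexp]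
      simp
    simp_rw [this]
    simp only [intervalIntegral.integral_const, sub_zero, Complex.real_smul]
    push_cast
    ring
  have hbound : ∀ θ : ℝ, ‖g (Complex.exp (θ * Complex.I) * y)‖ ≤ ∑' n, ‖b n * y ^ n‖ := by
    intro θ
    have h1 := hg (Complex.exp (θ * Complex.I) * y)
    rw [← h1.tsum_eq]
    refine (norm_tsum_le_tsum_norm h1.summable.norm).trans (le_of_eq ?_)
    congr 1; ext n
    rw [norm_mul, norm_mul, norm_pow, norm_pow, norm_mul, Complex.norm_exp_ofReal_mul_I, one_mul]
  have hfin := key (fun θ => (starRingEnd ℂ) (g (Complex.exp (θ * Complex.I) * y)))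
    (∑' n, ‖b n * y ^ n‖) (by fun_prop) (fun θ => by rw [RCLike.norm_conj]; exact hbound θ)
  have := Complex.hasSum_re hfin
  convert this using 1
  · ext n
    have h2 : ∫ θ in (0 : ℝ)..(2 * Real.pi), b n * y ^ n * Complex.exp (n * θ * Complex.I) *
        (starRingEnd ℂ) (g (Complex.exp (θ * Complex.I) * y)) =
        b n * y ^ n * (starRingEnd ℂ) (2 * Real.pi * (b n * y ^ n)) := by
      rw [← hcoef n, ← intervalIntegral.intervalIntegral_conj,
        ← intervalIntegral.integral_const_mul]
      congr 1; ext θ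
      simp only [map_mul, Complex.conj_conj]
      ring
    rw [h2]
    have h3 : b n * y ^ n * (starRingEnd ℂ) (2 * Real.pi * (b n * y ^ n)) =
        ((2 * Real.pi * (‖b n‖ ^ 2 * ‖y‖ ^ (2 * n)) : ℝ) : ℂ) := by
      rw [map_mul, mul_left_comm, Complex.mul_conj, Complex.normSq_eq_norm_sq]
      simp only [norm_mul, norm_pow, map_mul, Complex.conj_ofReal, map_ofNat]
      push_cast
      ring
    rw [h3, Complex.ofReal_re]
  · have h4 : ∫ θ in (0 : ℝ)..(2 * Real.pi), g (Complex.exp (θ * Complex.I) * y) *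
        (starRingEnd ℂ) (g (Complex.exp (θ * Complex.I) * y)) =
        ((∫ θ in (0 : ℝ)..(2 * Real.pi), ‖g (Complex.exp (θ * Complex.I) * y)‖ ^ 2 : ℝ) : ℂ) := by
      rw [← intervalIntegral.integral_ofReal]
      congr 1; ext θ
      rw [Complex.mul_conj, Complex.normSq_eq_norm_sq]
    rw [h4, Complex.ofReal_re]

theorem lintegral_rotate (θ : ℝ) (F : ℂ → ENNReal) :
    ∫⁻ y, F (Complex.exp (θ * Complex.I) * y) = ∫⁻ y, F y :=
  ((rotation (Circle.exp θ)).measurePreserving).lintegral_comp_emb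
    (rotation (Circle.exp θ)).toHomeomorph.measurableEmbedding F

/-- Parseval's identity for a radial weight. -/
theorem lintegral_radial_mul_sq_norm {b : ℕ → ℂ} {g : ℂ → ℂ}
    (hg : ∀ y, HasSum (fun n => b n * y ^ n) (g y)) (hc : Continuous g)
    {W : ℝ → ℝ} (hW : Continuous W) (hW0 : ∀ r, 0 ≤ W r) :
    ∫⁻ y, ENNReal.ofReal (W ‖y‖ * ‖g y‖ ^ 2) =
      ∑' n : ℕ, ∫⁻ y : ℂ, ENNReal.ofReal (‖b n‖ ^ 2 * (W ‖y‖ * ‖y‖ ^ (2 * n))) := by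
  have h2 : ENNReal.ofReal (2 * Real.pi) ≠ 0 := by simp [Real.pi_pos]
  rw [← ENNReal.mul_right_inj h2 ENNReal.ofReal_ne_top,
    ← lintegral_tsum fun n => (by fun_prop : Continuous fun y : ℂ =>
      ‖b n‖ ^ 2 * (W ‖y‖ * ‖y‖ ^ (2 * n))).measurable.ennreal_ofReal.aemeasurable]
  conv_rhs => rw [← lintegral_const_mul' _ _ ENNReal.ofReal_ne_top]
  -- Average over all rotations, which change neither the measure nor the weight; Tonelli then
  -- leaves a circle integral for each `y`.
  calc ENNReal.ofReal (2 * Real.pi) * ∫⁻ y, ENNReal.ofReal (W ‖y‖ * ‖g y‖ ^ 2)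
      = ∫⁻ θ in Set.Ioc (0 : ℝ) (2 * Real.pi), ∫⁻ y, ENNReal.ofReal
          (W ‖y‖ * ‖g (Complex.exp (θ * Complex.I) * y)‖ ^ 2) := by
        have : ∀ θ : ℝ, ∫⁻ y, ENNReal.ofReal
            (W ‖y‖ * ‖g (Complex.exp (θ * Complex.I) * y)‖ ^ 2) =
            ∫⁻ y, ENNReal.ofReal (W ‖y‖ * ‖g y‖ ^ 2) := fun θ => by
          rw [← lintegral_rotate θ fun y => ENNReal.ofReal (W ‖y‖ * ‖g y‖ ^ 2)]
          simp only [norm_mul, Complex.norm_exp_ofReal_mul_I, one_mul]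
        simp_rw [this]
        rw [setLIntegral_const, Real.volume_Ioc, sub_zero, mul_comm]
    _ = ∫⁻ y, ∫⁻ θ in Set.Ioc (0 : ℝ) (2 * Real.pi), ENNReal.ofReal
          (W ‖y‖ * ‖g (Complex.exp (θ * Complex.I) * y)‖ ^ 2) :=
        lintegral_lintegral_swap (by fun_prop : Continuous fun p : ℝ × ℂ =>
          W ‖p.2‖ * ‖g (Complex.exp (p.1 * Complex.I) * p.2)‖ ^ 2).measurable.ennreal_ofReal.aemeasurable
    _ = _ := by
        congr 1; ext y
        have hp := (hasSum_sq_norm_circle hg hc y).mul_left (W ‖y‖)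
        rw [intervalIntegral.integral_of_le Real.two_pi_pos.le, ← integral_const_mul] at hp
        rw [← ofReal_integral_eq_lintegral_ofReal, ← hp.tsum_eq,
          ENNReal.ofReal_tsum_of_nonneg _ hp.summable, ← ENNReal.tsum_mul_left]
        · congr 1; ext n
          rw [← ENNReal.ofReal_mul Real.two_pi_pos.le]
          ring_nf
        · intro n
          have := hW0 ‖y‖
          positivity
        · exact (by fun_prop : Continuous _).integrableOn_Ioc
        · exact Filter.Eventually.of_forall fun θ => mul_nonneg (hW0 _) (by positivity)

theorem hasSum_radial_mul_sq_norm {b : ℕ → ℂ} {g : ℂ → ℂ}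
    (hg : ∀ y, HasSum (fun n => b n * y ^ n) (g y)) (hc : Continuous g)
    {W : ℝ → ℝ} (hW : Continuous W) (hW0 : ∀ r, 0 ≤ W r)
    (hWi : ∀ n : ℕ, Integrable fun y : ℂ => W ‖y‖ * ‖y‖ ^ (2 * n))
    (hi : Integrable fun y : ℂ => W ‖y‖ * ‖g y‖ ^ 2) :
    HasSum (fun n : ℕ => ‖b n‖ ^ 2 * ∫ y : ℂ, W ‖y‖ * ‖y‖ ^ (2 * n))
      (∫ y : ℂ, W ‖y‖ * ‖g y‖ ^ 2) := by
  have h := lintegral_radial_mul_sq_norm hg hc hW hW0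
  have hn : ∀ n : ℕ, 0 ≤ ∫ y : ℂ, W ‖y‖ * ‖y‖ ^ (2 * n) := fun n =>
    integral_nonneg fun y => mul_nonneg (hW0 _) (by positivity)
  rw [← ofReal_integral_eq_lintegral_ofReal hi
    (Filter.Eventually.of_forall fun y => mul_nonneg (hW0 _) (by positivity))] at h
  have h1 : ∀ n : ℕ, ∫⁻ y : ℂ, ENNReal.ofReal (‖b n‖ ^ 2 * (W ‖y‖ * ‖y‖ ^ (2 * n))) =
      ENNReal.ofReal (‖b n‖ ^ 2 * ∫ y : ℂ, W ‖y‖ * ‖y‖ ^ (2 * n)) := fun n => by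
    rw [← integral_const_mul, ofReal_integral_eq_lintegral_ofReal ((hWi n).const_mul _)]
    exact Filter.Eventually.of_forall fun y =>
      mul_nonneg (by positivity) (mul_nonneg (hW0 _) (by positivity))
  simp_rw [h1] at h
  have h2 := ENNReal.hasSum_toReal (h ▸ ENNReal.ofReal_ne_top)
  rw [← ENNReal.tsum_toReal_eq fun n => ENNReal.ofReal_ne_top, ← h, ENNReal.toReal_ofReal
    (integral_nonneg fun y => mul_nonneg (hW0 _) (by positivity))] at h2
  exact h2.congr_fun fun n => (ENNReal.toReal_ofReal (mul_nonneg (by positivity) (hn n))).symm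

theorem integral_norm_pow_mul_exp {c : ℝ} (hc : 0 < c) (n : ℕ) :
    ∫ y : ℂ, Real.exp (-c * ‖y‖ ^ 2) * ‖y‖ ^ (2 * n) =
      Real.pi * n.factorial / c ^ (n + 1) := by
  have h := Complex.integral_rpow_mul_exp_neg_mul_rpow (p := 2) (q := ((2 * n : ℕ) : ℝ))
    (by norm_num) (by have : (0 : ℝ) ≤ ((2 * n : ℕ) : ℝ) := by positivity
                      linarith) hc
  simp_rw [Real.rpow_natCast, Real.rpow_two] at h
  simp_rw [mul_comm (Real.exp _)]
  rw [h]
  have e1 : ((2 * n : ℕ) + 2 : ℝ) / 2 = (n : ℝ) + 1 := by push_cast; ring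
  have e2 : -((2 * n : ℕ) + 2 : ℝ) / 2 = -((n + 1 : ℕ) : ℝ) := by push_cast; ring
  rw [e1, e2, Real.Gamma_nat_eq_factorial, Real.rpow_neg hc.le, Real.rpow_natCast]
  field_simp

theorem integrable_norm_pow_mul_exp {c : ℝ} (hc : 0 < c) (n : ℕ) :
    Integrable fun y : ℂ => Real.exp (-c * ‖y‖ ^ 2) * ‖y‖ ^ (2 * n) := by
  refine Integrable.of_integral_ne_zero ?_
  rw [integral_norm_pow_mul_exp hc]
  positivity

/-! ### Even entire functions and the spectrum of the fibre defect. -/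

theorem hasSum_quadratic {b : ℕ → ℂ} (hb : ∀ n, n ∉ ({0, 2} : Finset ℕ) → b n = 0) (y : ℂ) :
    HasSum (fun n => b n * y ^ n) (b 0 + b 2 * y ^ 2) := by
  have h : HasSum (fun n => b n * y ^ n) (∑ n ∈ ({0, 2} : Finset ℕ), b n * y ^ n) :=
    hasSum_sum_of_ne_finset_zero fun n hn => by rw [hb n hn, zero_mul]
  simpa using h

theorem coeff_zero_of_hasSum {b : ℕ → ℂ} {g : ℂ → ℂ}
    (hg : ∀ y, HasSum (fun n => b n * y ^ n) (g y)) : g 0 = b 0 := by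
  have h : HasSum (fun n => b n * (0 : ℂ) ^ n) (b 0 * 0 ^ 0) :=
    hasSum_single 0 fun n hn => by simp [hn]
  simpa using (hg 0).unique h

/-- Averaging the Taylor series at `y` and `-y` kills all odd coefficients. Only `b 1 = 0` is
recorded, since `n = 1` is the one mode with a negative eigenvalue. -/
theorem exists_hasSum_of_even {g : ℂ → ℂ} (hg : Differentiable ℂ g) (he : ∀ y, g (-y) = g y) :
    ∃ b : ℕ → ℂ, (∀ y, HasSum (fun n => b n * y ^ n) (g y)) ∧ b 1 = 0 := by
  refine ⟨fun n => (1 + (-1) ^ n) / 2 * ((n.factorial : ℂ)⁻¹ * iteratedDeriv n g 0),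
    fun y => ?_, by simp⟩
  have h1 := Complex.hasSum_taylorSeries_of_entire hg 0 y
  have h2 := Complex.hasSum_taylorSeries_of_entire hg 0 (-y)
  rw [he] at h2
  have h3 := (h1.add h2).mul_left (1 / 2 : ℂ)
  rw [show 1 / 2 * (g y + g y) = g y by ring] at h3
  refine h3.congr_fun fun n => ?_
  simp only [sub_zero, smul_eq_mul]
  rw [neg_pow y]
  ring

/-- The quadratic form of the relative variable: the energy defect of a fibre. -/
def fiberDefect (g : ℂ → ℂ) : ℝ :=
  Real.pi / 2 * ‖g 0‖ ^ 2 +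
    ((∫ y : ℂ, Real.exp (-2 * ‖y‖ ^ 2) * ‖y‖ ^ 2 * ‖g y‖ ^ 2) -
      3 / 2 * ∫ y : ℂ, Real.exp (-2 * ‖y‖ ^ 2) * ‖g y‖ ^ 2)

theorem hasSum_fiber {b : ℕ → ℂ} {g : ℂ → ℂ}
    (hg : ∀ y, HasSum (fun n => b n * y ^ n) (g y)) (hc : Continuous g)
    (hi0 : Integrable fun y : ℂ => Real.exp (-2 * ‖y‖ ^ 2) * ‖g y‖ ^ 2)
    (hi1 : Integrable fun y : ℂ => Real.exp (-2 * ‖y‖ ^ 2) * ‖y‖ ^ 2 * ‖g y‖ ^ 2) :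
    HasSum (fun n : ℕ => ‖b n‖ ^ 2 * (Real.pi * n.factorial / 2 ^ (n + 1)))
        (∫ y : ℂ, Real.exp (-2 * ‖y‖ ^ 2) * ‖g y‖ ^ 2) ∧
      HasSum (fun n : ℕ => ‖b n‖ ^ 2 * (Real.pi * (n + 1).factorial / 2 ^ (n + 2)))
        (∫ y : ℂ, Real.exp (-2 * ‖y‖ ^ 2) * ‖y‖ ^ 2 * ‖g y‖ ^ 2) := by
  have e : ∀ (n : ℕ) (y : ℂ), Real.exp (-2 * ‖y‖ ^ 2) * ‖y‖ ^ 2 * ‖y‖ ^ (2 * n) =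
      Real.exp (-2 * ‖y‖ ^ 2) * ‖y‖ ^ (2 * (n + 1)) := fun n y => by ring
  constructor
  · have := hasSum_radial_mul_sq_norm (W := fun r => Real.exp (-2 * r ^ 2)) hg hc (by fun_prop)
      (fun r => by positivity) (fun n => integrable_norm_pow_mul_exp two_pos n) hi0
    simpa only [integral_norm_pow_mul_exp two_pos] using this
  · have := hasSum_radial_mul_sq_norm (W := fun r => Real.exp (-2 * r ^ 2) * r ^ 2) hg hc
      (by fun_prop) (fun r => by positivity)
      (fun n => by simpa only [e] using integrable_norm_pow_mul_exp two_pos (n + 1)) hi1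
    simpa only [e, integral_norm_pow_mul_exp two_pos] using this

/-- The second moment of `y^n` is `(n + 1)/2` times its mass, so subtracting `3/2` leaves `(n -
2)/2`. For `n = 0` this is `-1`, cancelled by the term in `‖g 0‖ ^ 2`; for `n = 1` the coefficient
is absent. The truncated subtraction `n - 2` is therefore correct at both indices. -/
theorem hasSum_fiberDefect {b : ℕ → ℂ} {g : ℂ → ℂ}
    (hg : ∀ y, HasSum (fun n => b n * y ^ n) (g y)) (hb : b 1 = 0) (hc : Continuous g)
    (hi0 : Integrable fun y : ℂ => Real.exp (-2 * ‖y‖ ^ 2) * ‖g y‖ ^ 2)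
    (hi1 : Integrable fun y : ℂ => Real.exp (-2 * ‖y‖ ^ 2) * ‖y‖ ^ 2 * ‖g y‖ ^ 2) :
    HasSum (fun n : ℕ => ‖b n‖ ^ 2 * (Real.pi * n.factorial / 2 ^ (n + 2)) * ((n - 2 : ℕ) : ℝ))
      (fiberDefect g) := by
  obtain ⟨h0, h1⟩ := hasSum_fiber hg hc hi0 hi1
  have hg0 : g 0 = b 0 := coeff_zero_of_hasSum hg
  have h2 : HasSum (fun n : ℕ => if n = 0 then Real.pi / 2 * ‖g 0‖ ^ 2 else 0)
      (Real.pi / 2 * ‖g 0‖ ^ 2) := hasSum_ite_eq 0 _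
  refine (h2.add (h1.sub (h0.mul_left (3 / 2)))).congr_fun fun n => ?_
  match n with
  | 0 => simp [hg0]; ring
  | 1 => simp [hb]
  | n + 2 =>
    simp only [Nat.factorial_succ, Nat.add_sub_cancel]
    push_cast
    field_simp
    ring

theorem fiberDefect_nonneg {g : ℂ → ℂ} (hg : Differentiable ℂ g) (he : ∀ y, g (-y) = g y)
    (hi0 : Integrable fun y : ℂ => Real.exp (-2 * ‖y‖ ^ 2) * ‖g y‖ ^ 2)
    (hi1 : Integrable fun y : ℂ => Real.exp (-2 * ‖y‖ ^ 2) * ‖y‖ ^ 2 * ‖g y‖ ^ 2) :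
    0 ≤ fiberDefect g := by
  obtain ⟨b, hb, hb1⟩ := exists_hasSum_of_even hg he
  exact (hasSum_fiberDefect hb hb1 hg.continuous hi0 hi1).nonneg fun n => by positivity

/-- The coefficients are written through the values of `g` at 0 and 1 so that, for a family of
fibres, they depend continuously on the parameter. -/
theorem eq_quadratic_of_fiberDefect_eq_zero {g : ℂ → ℂ} (hg : Differentiable ℂ g)
    (he : ∀ y, g (-y) = g y)
    (hi0 : Integrable fun y : ℂ => Real.exp (-2 * ‖y‖ ^ 2) * ‖g y‖ ^ 2)
    (hi1 : Integrable fun y : ℂ => Real.exp (-2 * ‖y‖ ^ 2) * ‖y‖ ^ 2 * ‖g y‖ ^ 2)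
    (h : fiberDefect g = 0) (y : ℂ) : g y = g 0 + (g 1 - g 0) * y ^ 2 := by
  obtain ⟨b, hb, hb1⟩ := exists_hasSum_of_even hg he
  have hs := hasSum_fiberDefect hb hb1 hg.continuous hi0 hi1
  rw [h, hasSum_zero_iff_of_nonneg fun n => by positivity] at hs
  have hz : ∀ n, n ∉ ({0, 2} : Finset ℕ) → b n = 0 := by
    intro n hn
    simp only [Finset.mem_insert, Finset.mem_singleton, not_or] at hn
    by_cases h1 : n = 1
    · rw [h1, hb1]
    have h2 : ((n - 2 : ℕ) : ℝ) ≠ 0 := by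
      rw [Nat.cast_ne_zero]; omega
    have h3 := congrFun hs n
    simpa [h2, Real.pi_ne_zero, Nat.factorial_ne_zero] using h3
  have hq : ∀ y, g y = b 0 + b 2 * y ^ 2 := fun y => (hb y).unique (hasSum_quadratic hz y)
  rw [hq y, hq 0, hq 1]
  ring

theorem fiberDefect_quadratic {g : ℂ → ℂ} {A B : ℂ} (hg : ∀ y, g y = A + B * y ^ 2)
    (hi0 : Integrable fun y : ℂ => Real.exp (-2 * ‖y‖ ^ 2) * ‖g y‖ ^ 2)
    (hi1 : Integrable fun y : ℂ => Real.exp (-2 * ‖y‖ ^ 2) * ‖y‖ ^ 2 * ‖g y‖ ^ 2) :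
    fiberDefect g = 0 := by
  let b : ℕ → ℂ := fun n => if n = 0 then A else if n = 2 then B else 0
  have hb : ∀ y, HasSum (fun n => b n * y ^ n) (g y) := fun y => by
    have h := hasSum_quadratic (b := b) (fun n hn => by
      simp only [Finset.mem_insert, Finset.mem_singleton, not_or] at hn
      simp [b, hn]) y
    simpa [b, ← hg] using h
  have hc : Continuous g := by
    rw [show g = fun y => A + B * y ^ 2 from funext hg]
    fun_prop
  refine (hasSum_fiberDefect hb (by simp [b]) hc hi0 hi1).unique ?_
  convert hasSum_zero using 1
  ext n
  by_cases h0 : n = 0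
  · simp [h0]
  by_cases h2 : n = 2
  · simp [h2]
  simp [b, h0, h2]

/-- Keep only the term `n = 0` of Parseval. This yields the integrability of `|u|⁴`. -/
theorem sq_norm_zero_le_integral {g : ℂ → ℂ} (hg : Differentiable ℂ g) (he : ∀ y, g (-y) = g y)
    (hi0 : Integrable fun y : ℂ => Real.exp (-2 * ‖y‖ ^ 2) * ‖g y‖ ^ 2)
    (hi1 : Integrable fun y : ℂ => Real.exp (-2 * ‖y‖ ^ 2) * ‖y‖ ^ 2 * ‖g y‖ ^ 2) :
    Real.pi / 2 * ‖g 0‖ ^ 2 ≤ ∫ y : ℂ, Real.exp (-2 * ‖y‖ ^ 2) * ‖g y‖ ^ 2 := by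
  obtain ⟨b, hb, hb1⟩ := exists_hasSum_of_even hg he
  have h := (hasSum_fiber hb hg.continuous hi0 hi1).1
  have hg0 : g 0 = b 0 := coeff_zero_of_hasSum hb
  refine le_trans (le_of_eq ?_) (le_hasSum h 0 fun n _ => by positivity)
  rw [hg0]
  simp
  ring

/-! ### Centre-of-mass and relative variables for a pair of points. -/

theorem measurePreserving_centerOfMass :
    MeasurePreserving (fun p : ℂ × ℂ => (p.1 / 2 + p.2, p.1 / 2 - p.2)) := by
  have h1 : MeasurePreserving (fun p : ℂ × ℂ => (p.1, p.1 / 2 - p.2)) :=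
    MeasurePreserving.skew_product (g := fun s x => s / 2 - x) (MeasurePreserving.id volume)
      (by fun_prop) (Filter.Eventually.of_forall fun s =>
        (Measure.measurePreserving_sub_left volume (s / 2)).map_eq)
  have h2 : MeasurePreserving (fun p : ℂ × ℂ => (p.1 - p.2, p.2)) :=
    measurePreserving_sub_prod volume volume
  convert h2.comp h1 using 1
  ext p <;> simp
  ring

theorem integrable_id_mul {ρ : ℂ → ℝ} (h0 : ∀ z, 0 ≤ ρ z) (hi : Integrable ρ)
    (hi2 : Integrable fun z => ‖z‖ ^ 2 * ρ z) : Integrable fun z : ℂ => z * (ρ z : ℂ) := by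
  refine (hi.add hi2).mono' ?_ (Filter.Eventually.of_forall fun z => ?_)
  · exact continuous_id.aestronglyMeasurable.mul hi.ofReal.aestronglyMeasurable
  · rw [norm_mul, Complex.norm_real, Real.norm_of_nonneg (h0 z)]
    simp only [Pi.add_apply]
    nlinarith [h0 z, sq_nonneg (‖z‖ - 1), mul_nonneg (h0 z) (sq_nonneg (‖z‖ - 1)),
      mul_nonneg (h0 z) (sq_nonneg ‖z‖)]

section TwoBody

variable {ρ : ℂ → ℝ}

theorem integrable_pair (hi : Integrable ρ) :
    Integrable fun p : ℂ × ℂ => ρ (p.1 / 2 + p.2) * ρ (p.1 / 2 - p.2) :=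
  measurePreserving_centerOfMass.integrable_comp_of_integrable (hi.mul_prod hi)

theorem integral_pair (hi : Integrable ρ) :
    ∫ p : ℂ × ℂ, ρ (p.1 / 2 + p.2) * ρ (p.1 / 2 - p.2) = (∫ z, ρ z) ^ 2 := by
  have h := (hi.mul_prod hi).aestronglyMeasurable
  rw [← Measure.volume_eq_prod, ← measurePreserving_centerOfMass.map_eq] at h
  rw [sq, ← integral_prod_mul ρ ρ, ← Measure.volume_eq_prod]
  conv_rhs => rw [← measurePreserving_centerOfMass.map_eq]
  rw [integral_map measurePreserving_centerOfMass.aemeasurable h]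

/-- Expand `|z - w|² = |z|² + |w|² - 2 Re(z w̄)`; the cross term factors as the first moment times
its conjugate. -/
theorem hasIntegral_dist_sq (h0 : ∀ z, 0 ≤ ρ z) (hi : Integrable ρ)
    (hi2 : Integrable fun z => ‖z‖ ^ 2 * ρ z) :
    Integrable (fun p : ℂ × ℂ => ‖p.1 - p.2‖ ^ 2 * (ρ p.1 * ρ p.2)) ∧
    ∫ p : ℂ × ℂ, ‖p.1 - p.2‖ ^ 2 * (ρ p.1 * ρ p.2) =
      2 * ((∫ z, ρ z) * (∫ z, ‖z‖ ^ 2 * ρ z) - ‖∫ z, z * (ρ z : ℂ)‖ ^ 2) := by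
  have hz := integrable_id_mul h0 hi hi2
  have hzc : Integrable fun z : ℂ => (starRingEnd ℂ) (z * (ρ z : ℂ)) := by
    simpa using (Complex.conjLIE.toContinuousLinearEquiv.toContinuousLinearMap).integrable_comp hz
  have i1 : Integrable fun p : ℂ × ℂ => (‖p.1‖ ^ 2 * ρ p.1) * ρ p.2 := hi2.mul_prod hi
  have i2 : Integrable fun p : ℂ × ℂ => ρ p.1 * (‖p.2‖ ^ 2 * ρ p.2) := hi.mul_prod hi2
  have i3 : Integrable fun p : ℂ × ℂ => (p.1 * (ρ p.1 : ℂ)) *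
      (starRingEnd ℂ) (p.2 * (ρ p.2 : ℂ)) := hz.mul_prod hzc
  have e : ∀ p : ℂ × ℂ, ‖p.1 - p.2‖ ^ 2 * (ρ p.1 * ρ p.2) =
      (‖p.1‖ ^ 2 * ρ p.1) * ρ p.2 + ρ p.1 * (‖p.2‖ ^ 2 * ρ p.2) -
        2 * ((p.1 * (ρ p.1 : ℂ)) * (starRingEnd ℂ) (p.2 * (ρ p.2 : ℂ))).re := fun p => by
    simp only [← Complex.normSq_eq_norm_sq, Complex.normSq_apply, map_mul, Complex.conj_ofReal,
      Complex.mul_re, Complex.mul_im, Complex.sub_re, Complex.sub_im, Complex.conj_re,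
      Complex.conj_im, Complex.ofReal_re, Complex.ofReal_im]
    ring
  have i3r := i3.re
  simp only [RCLike.re_to_complex] at i3r
  simp_rw [e]
  refine ⟨(i1.add i2).sub (i3r.const_mul 2), ?_⟩
  rw [integral_sub (by exact i1.add i2) (i3r.const_mul 2), integral_add i1 i2, integral_const_mul]
  have e3 : ∫ p : ℂ × ℂ, ((p.1 * (ρ p.1 : ℂ)) * (starRingEnd ℂ) (p.2 * (ρ p.2 : ℂ))).re =
      ‖∫ z, z * (ρ z : ℂ)‖ ^ 2 := by
    have := integral_re i3
    simp only [RCLike.re_to_complex] at this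
    rw [this, Measure.volume_eq_prod, integral_prod_mul (fun z : ℂ => z * (ρ z : ℂ))
      (fun z : ℂ => (starRingEnd ℂ) (z * (ρ z : ℂ))), integral_conj, Complex.mul_conj,
      Complex.ofReal_re, Complex.normSq_eq_norm_sq]
  rw [e3, Measure.volume_eq_prod, integral_prod_mul (fun z : ℂ => ‖z‖ ^ 2 * ρ z) ρ,
    integral_prod_mul ρ (fun z : ℂ => ‖z‖ ^ 2 * ρ z)]
  ring

theorem norm_relative_sq (p : ℂ × ℂ) :
    ‖(p.1 / 2 + p.2) - (p.1 / 2 - p.2)‖ ^ 2 = 4 * ‖p.2‖ ^ 2 := by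
  rw [show (p.1 / 2 + p.2) - (p.1 / 2 - p.2) = 2 * p.2 by ring, norm_mul]
  norm_num
  ring

theorem integrable_pair_sq (h0 : ∀ z, 0 ≤ ρ z) (hi : Integrable ρ)
    (hi2 : Integrable fun z => ‖z‖ ^ 2 * ρ z) :
    Integrable fun p : ℂ × ℂ => ‖p.2‖ ^ 2 * (ρ (p.1 / 2 + p.2) * ρ (p.1 / 2 - p.2)) := by
  have h := measurePreserving_centerOfMass.integrable_comp_of_integrable
    (hasIntegral_dist_sq h0 hi hi2).1
  refine (h.const_mul (1 / 4)).congr (Filter.Eventually.of_forall fun p => ?_)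
  simp only [Function.comp_apply, norm_relative_sq]
  ring

theorem integral_pair_sq (h0 : ∀ z, 0 ≤ ρ z) (hi : Integrable ρ)
    (hi2 : Integrable fun z => ‖z‖ ^ 2 * ρ z) :
    ∫ p : ℂ × ℂ, ‖p.2‖ ^ 2 * (ρ (p.1 / 2 + p.2) * ρ (p.1 / 2 - p.2)) =
      1 / 2 * ((∫ z, ρ z) * (∫ z, ‖z‖ ^ 2 * ρ z) - ‖∫ z, z * (ρ z : ℂ)‖ ^ 2) := by
  obtain ⟨h, he⟩ := hasIntegral_dist_sq h0 hi hi2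
  have hm := h.aestronglyMeasurable
  rw [← measurePreserving_centerOfMass.map_eq] at hm he
  rw [integral_map measurePreserving_centerOfMass.aemeasurable hm] at he
  simp only [norm_relative_sq, mul_assoc] at he
  rw [integral_const_mul] at he
  linarith

end TwoBody

/-! ### The energy as an integral over fibres. -/

/-- The entire function `x ↦ f (s/2 + x) f (s/2 - x)` of the relative variable. -/
def fiber (f : ℂ → ℂ) (s x : ℂ) : ℂ := f (s / 2 + x) * f (s / 2 - x)

theorem fiber_differentiable {f : ℂ → ℂ} (hf : Differentiable ℂ f) (s : ℂ) :
    Differentiable ℂ (fiber f s) := by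
  unfold fiber
  fun_prop

theorem fiber_even (f : ℂ → ℂ) (s x : ℂ) : fiber f s (-x) = fiber f s x := by
  simp only [fiber, sub_neg_eq_add, ← sub_eq_add_neg]
  ring

section Fiber

variable {u f : ℂ → ℂ}

/-- By the parallelogram law the product of the two Gaussians splits into a Gaussian in `s` and one
in `x`. -/
theorem pair_eq_fiber (hu : ∀ z, u z = ((Real.exp (-‖z‖ ^ 2 / 2) : ℝ) : ℂ) * f z) (s x : ℂ) :
    ‖u (s / 2 + x)‖ ^ 2 * ‖u (s / 2 - x)‖ ^ 2 =
      Real.exp (-‖s‖ ^ 2 / 2) * (Real.exp (-2 * ‖x‖ ^ 2) * ‖fiber f s x‖ ^ 2) := by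
  have hn : ∀ z, ‖u z‖ ^ 2 = Real.exp (-‖z‖ ^ 2) * ‖f z‖ ^ 2 := fun z => by
    rw [hu, norm_mul, mul_pow, Complex.norm_real, Real.norm_of_nonneg (Real.exp_pos _).le,
      ← Real.exp_nat_mul]
    congr 2
    push_cast
    ring
  have hp : ‖s / 2 + x‖ ^ 2 + ‖s / 2 - x‖ ^ 2 = ‖s‖ ^ 2 / 2 + 2 * ‖x‖ ^ 2 := by
    have := parallelogram_law_with_norm ℝ (s / 2) x
    rw [norm_div] at this
    norm_num at this
    nlinarith [this]
  have he : Real.exp (-‖s / 2 + x‖ ^ 2) * Real.exp (-‖s / 2 - x‖ ^ 2) =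
      Real.exp (-‖s‖ ^ 2 / 2) * Real.exp (-2 * ‖x‖ ^ 2) := by
    rw [← Real.exp_add, ← Real.exp_add]
    congr 1
    linarith
  rw [hn, hn, fiber, norm_mul]
  linear_combination (‖f (s / 2 + x)‖ ^ 2 * ‖f (s / 2 - x)‖ ^ 2) * he

theorem ae_integrable_fiber (hu : ∀ z, u z = ((Real.exp (-‖z‖ ^ 2 / 2) : ℝ) : ℂ) * f z)
    (hi : Integrable fun z => ‖u z‖ ^ 2) (hi2 : Integrable fun z => ‖z‖ ^ 2 * ‖u z‖ ^ 2) :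
    ∀ᵐ s, (Integrable fun y : ℂ => Real.exp (-2 * ‖y‖ ^ 2) * ‖fiber f s y‖ ^ 2) ∧
      Integrable fun y : ℂ => Real.exp (-2 * ‖y‖ ^ 2) * ‖y‖ ^ 2 * ‖fiber f s y‖ ^ 2 := by
  have h1 := integrable_pair hi
  have h2 := integrable_pair_sq (fun z => by positivity) hi hi2
  rw [Measure.volume_eq_prod] at h1 h2
  filter_upwards [h1.prod_right_ae, h2.prod_right_ae] with s a1 a2
  simp only [pair_eq_fiber hu] at a1 a2
  have hne : Real.exp (-‖s‖ ^ 2 / 2) ≠ 0 := (Real.exp_pos _).ne'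
  constructor
  · refine (a1.const_mul (Real.exp (-‖s‖ ^ 2 / 2))⁻¹).congr (Filter.Eventually.of_forall fun y => ?_)
    simp only
    field_simp
  · refine (a2.const_mul (Real.exp (-‖s‖ ^ 2 / 2))⁻¹).congr (Filter.Eventually.of_forall fun y => ?_)
    simp only
    field_simp

theorem norm_pow_four_eq (hu : ∀ z, u z = ((Real.exp (-‖z‖ ^ 2 / 2) : ℝ) : ℂ) * f z) (s : ℂ) :
    ‖u ((1 / 2 : ℝ) • s)‖ ^ 4 = Real.exp (-‖s‖ ^ 2 / 2) * ‖fiber f s 0‖ ^ 2 := by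
  have := pair_eq_fiber hu s 0
  simp only [add_zero, sub_zero, norm_zero] at this
  norm_num at this
  rw [← this, show (1 / 2 : ℝ) • s = s / 2 by rw [Complex.real_smul]; push_cast; ring]
  ring

theorem integrable_norm_pow_four (hu : ∀ z, u z = ((Real.exp (-‖z‖ ^ 2 / 2) : ℝ) : ℂ) * f z)
    (hf : Differentiable ℂ f) (hi : Integrable fun z => ‖u z‖ ^ 2)
    (hi2 : Integrable fun z => ‖z‖ ^ 2 * ‖u z‖ ^ 2) :
    Integrable fun s : ℂ => ‖u ((1 / 2 : ℝ) • s)‖ ^ 4 := by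
  have h1 := integrable_pair hi
  rw [Measure.volume_eq_prod] at h1
  have hc : Continuous u := by
    rw [show u = _ from funext hu]
    have := hf.continuous
    fun_prop
  refine (h1.integral_prod_left.const_mul (2 / Real.pi)).mono'
    (by fun_prop : Continuous _).aestronglyMeasurable ?_
  filter_upwards [ae_integrable_fiber hu hi hi2] with s hs
  rw [Real.norm_of_nonneg (by positivity), norm_pow_four_eq hu]
  simp only [pair_eq_fiber hu]
  rw [integral_const_mul]
  have h := sq_norm_zero_le_integral (fiber_differentiable hf s) (fiber_even f s) hs.1 hs.2
  have h' : ‖fiber f s 0‖ ^ 2 ≤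
      2 / Real.pi * ∫ y : ℂ, Real.exp (-2 * ‖y‖ ^ 2) * ‖fiber f s y‖ ^ 2 := by
    rw [div_mul_eq_mul_div, le_div_iff₀ Real.pi_pos]
    linarith
  calc _ ≤ Real.exp (-‖s‖ ^ 2 / 2) *
        (2 / Real.pi * ∫ y : ℂ, Real.exp (-2 * ‖y‖ ^ 2) * ‖fiber f s y‖ ^ 2) := by gcongr
    _ = _ := by ring

/-- The energy defect at `μ = 1/2`, up to translation, is an integral of nonnegative fibre
defects. -/
theorem hasIntegral_fiberDefect (hu : ∀ z, u z = ((Real.exp (-‖z‖ ^ 2 / 2) : ℝ) : ℂ) * f z)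
    (hf : Differentiable ℂ f) (hi : Integrable fun z => ‖u z‖ ^ 2)
    (hi2 : Integrable fun z => ‖z‖ ^ 2 * ‖u z‖ ^ 2) :
    Integrable (fun s => Real.exp (-‖s‖ ^ 2 / 2) * fiberDefect (fiber f s)) ∧
      ∫ s, Real.exp (-‖s‖ ^ 2 / 2) * fiberDefect (fiber f s) =
        2 * Real.pi * (∫ z, ‖u z‖ ^ 4) +
          (1 / 2 * ((∫ z, ‖u z‖ ^ 2) * (∫ z, ‖z‖ ^ 2 * ‖u z‖ ^ 2) -
            ‖∫ z, z * ((‖u z‖ ^ 2 : ℝ) : ℂ)‖ ^ 2) - 3 / 2 * (∫ z, ‖u z‖ ^ 2) ^ 2) := by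
  have h0 : ∀ z, 0 ≤ ‖u z‖ ^ 2 := fun z => by positivity
  have j1 := integral_pair hi
  have j2 := integral_pair_sq h0 hi hi2
  have h1 := integrable_pair hi
  have h2 := integrable_pair_sq h0 hi hi2
  have h4 := integrable_norm_pow_four hu hf hi hi2
  rw [Measure.volume_eq_prod] at h1 h2 j1 j2
  rw [integral_prod _ h1] at j1
  rw [integral_prod _ h2] at j2
  have k1 := h1.integral_prod_left
  have k2 := h2.integral_prod_left
  have e : ∀ s, Real.exp (-‖s‖ ^ 2 / 2) * fiberDefect (fiber f s) =
      Real.pi / 2 * ‖u ((1 / 2 : ℝ) • s)‖ ^ 4 +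
        ((∫ x, ‖x‖ ^ 2 * (‖u (s / 2 + x)‖ ^ 2 * ‖u (s / 2 - x)‖ ^ 2)) -
          3 / 2 * ∫ x, ‖u (s / 2 + x)‖ ^ 2 * ‖u (s / 2 - x)‖ ^ 2) := fun s => by
    rw [norm_pow_four_eq hu]
    simp only [pair_eq_fiber hu, fiberDefect]
    rw [integral_const_mul, ← integral_const_mul (Real.exp (-‖s‖ ^ 2 / 2))]
    have : ∀ x : ℂ, ‖x‖ ^ 2 * (Real.exp (-‖s‖ ^ 2 / 2) *
        (Real.exp (-2 * ‖x‖ ^ 2) * ‖fiber f s x‖ ^ 2)) = Real.exp (-‖s‖ ^ 2 / 2) *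
        (Real.exp (-2 * ‖x‖ ^ 2) * ‖x‖ ^ 2 * ‖fiber f s x‖ ^ 2) := fun x => by ring
    simp only [this, integral_const_mul]
    ring
  simp_rw [e]
  have k3 := k2.sub (k1.const_mul (3 / 2))
  refine ⟨(h4.const_mul _).add k3, ?_⟩
  -- Scaling by 1/2 in real dimension 2 contributes a factor 4, which turns `π/2` into `2π`.
  rw [integral_add (h4.const_mul _) (by exact k3), integral_sub k2 (k1.const_mul _),
    integral_const_mul, integral_const_mul, j1, j2,
    Measure.integral_comp_smul volume (fun z => ‖u z‖ ^ 4), Complex.finrank_real_complex]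
  norm_num
  ring

theorem ae_fiberDefect_nonneg (hu : ∀ z, u z = ((Real.exp (-‖z‖ ^ 2 / 2) : ℝ) : ℂ) * f z)
    (hf : Differentiable ℂ f) (hi : Integrable fun z => ‖u z‖ ^ 2)
    (hi2 : Integrable fun z => ‖z‖ ^ 2 * ‖u z‖ ^ 2) :
    ∀ᵐ s, 0 ≤ Real.exp (-‖s‖ ^ 2 / 2) * fiberDefect (fiber f s) := by
  filter_upwards [ae_integrable_fiber hu hi hi2] with s hs
  exact mul_nonneg (Real.exp_pos _).le
    (fiberDefect_nonneg (fiber_differentiable hf s) (fiber_even f s) hs.1 hs.2)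

/-- Vanishing of the total defect forces every fibre to be a quadratic polynomial. -/
theorem fiber_quadratic (hu : ∀ z, u z = ((Real.exp (-‖z‖ ^ 2 / 2) : ℝ) : ℂ) * f z)
    (hf : Differentiable ℂ f) (hi : Integrable fun z => ‖u z‖ ^ 2)
    (hi2 : Integrable fun z => ‖z‖ ^ 2 * ‖u z‖ ^ 2)
    (h : ∫ s, Real.exp (-‖s‖ ^ 2 / 2) * fiberDefect (fiber f s) = 0) (s x : ℂ) :
    fiber f s x = fiber f s 0 + (fiber f s 1 - fiber f s 0) * x ^ 2 := by
  have hz := (integral_eq_zero_iff_of_nonneg_ae (ae_fiberDefect_nonneg hu hf hi hi2)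
    (hasIntegral_fiberDefect hu hf hi hi2).1).1 h
  -- Fix `x`: the identity holds for almost every `s`, and both sides are continuous in `s`.
  have hae : ∀ᵐ s : ℂ, fiber f s x = fiber f s 0 + (fiber f s 1 - fiber f s 0) * x ^ 2 := by
    filter_upwards [hz, ae_integrable_fiber hu hi hi2] with s hs hsi
    refine eq_quadratic_of_fiberDefect_eq_zero (fiber_differentiable hf s) (fiber_even f s)
      hsi.1 hsi.2 ?_ x
    simpa [(Real.exp_pos _).ne'] using hs
  have hc := hf.continuous
  have := Continuous.ae_eq_iff_eq (μ := (volume : Measure ℂ))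
    (f := fun s => fiber f s x) (g := fun s => fiber f s 0 + (fiber f s 1 - fiber f s 0) * x ^ 2)
    (by unfold fiber; fun_prop) (by unfold fiber; fun_prop)
  exact congrFun (this.1 hae) s

theorem integral_fiberDefect_eq_zero
    (hu : ∀ z, u z = ((Real.exp (-‖z‖ ^ 2 / 2) : ℝ) : ℂ) * f z)
    (hi : Integrable fun z => ‖u z‖ ^ 2) (hi2 : Integrable fun z => ‖z‖ ^ 2 * ‖u z‖ ^ 2)
    (A B : ℂ → ℂ) (h : ∀ s x, fiber f s x = A s + B s * x ^ 2) :
    ∫ s, Real.exp (-‖s‖ ^ 2 / 2) * fiberDefect (fiber f s) = 0 := by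
  refine integral_eq_zero_of_ae ?_
  filter_upwards [ae_integrable_fiber hu hi hi2] with s hs
  simp [fiberDefect_quadratic (h s) hs.1 hs.2]

end Fiber

/-! ### Solving the functional equation. -/

/-- Differentiating in `w` at 0 gives the linear equation `g' = β g` with `β = g'(0)/g(0)`. -/
theorem eq_exp_of_mul_eq {g : ℂ → ℂ} (hg : Differentiable ℂ g)
    (h : ∀ z w, g z * g w = g (z + w) * g 0) (hne : ∃ z, g z ≠ 0) :
    ∃ C β : ℂ, ∀ z, g z = C * Complex.exp (β * z) := by
  obtain ⟨z₀, hz₀⟩ := hne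
  have h0 : g 0 ≠ 0 := fun h0 => hz₀ (by simpa [h0] using h z₀ z₀)
  have hd : ∀ z, HasDerivAt g (deriv g 0 / g 0 * g z) z := fun z => by
    have h1 : HasDerivAt (fun w => g z * g w) (g z * deriv g 0) 0 :=
      (hg 0).hasDerivAt.const_mul (g z)
    have h2 : HasDerivAt (fun w => g (z + w) * g 0) (deriv g z * g 0) 0 := by
      have h3 : HasDerivAt g (deriv g z) (z + 0) := by rw [add_zero]; exact (hg z).hasDerivAt
      exact (h3.comp_const_add z 0).mul_const (g 0)
    have h4 := h1.unique ((funext (h z) : (fun w => g z * g w) = _) ▸ h2)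
    have h5 : deriv g z = deriv g 0 / g 0 * g z := by
      rw [div_mul_eq_mul_div, eq_div_iff h0]
      linear_combination -h4
    rw [← h5]
    exact (hg z).hasDerivAt
  set β := deriv g 0 / g 0
  have hd2 : ∀ z, HasDerivAt (fun z => g z * Complex.exp (-(β * z))) 0 z := fun z => by
    have h1 : HasDerivAt (fun z => Complex.exp (-(β * z))) (Complex.exp (-(β * z)) * -(β * 1)) z :=
      ((hasDerivAt_id z).const_mul β).neg.cexp
    refine ((hd z).mul h1).congr_deriv ?_
    ring
  refine ⟨g 0, β, fun z => ?_⟩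
  have h1 := is_const_of_deriv_eq_zero (fun z => (hd2 z).differentiableAt)
    (fun z => (hd2 z).deriv) z 0
  simp only [mul_zero, neg_zero, Complex.exp_zero, mul_one] at h1
  rw [← h1, mul_assoc, ← Complex.exp_add]
  simp

/-- Entire functions all of whose fibres are even quadratic polynomials. -/
theorem eq_affine_mul_exp_of_fiber {f : ℂ → ℂ} (hf : Differentiable ℂ f) (hne : ∃ z, f z ≠ 0)
    (h : ∀ s x, fiber f s x = fiber f s 0 + (fiber f s 1 - fiber f s 0) * x ^ 2) :
    ∃ p q β : ℂ, ∀ z, f z = (p * z + q) * Complex.exp (β * z) := by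
  set B : ℂ → ℂ := fun s => fiber f s 1 - fiber f s 0 with hB
  have hBc : Continuous B := by
    have := hf.continuous
    simp only [hB, fiber]
    fun_prop
  have hzw : ∀ z w, f z * f w = fiber f (z + w) 0 + B (z + w) * ((z - w) / 2) ^ 2 := fun z w => by
    rw [← h, fiber]
    ring_nf
  by_cases hz : ∃ a, f a = 0
  · obtain ⟨a, ha⟩ := hz
    -- The pair `(a, z + w - a)` has the same sum and product zero, which eliminates the constant
    -- term; then `((z-w)² - (z+w-2a)²)/4 = -(z-a)(w-a)`.
    have hprod : ∀ z w, f z * f w = -B (z + w) * ((z - a) * (w - a)) := fun z w => by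
      have h1 := hzw a (z + w - a)
      rw [ha, zero_mul, add_sub_cancel] at h1
      rw [hzw]
      linear_combination -h1
    set g := dslope f a with hgdef
    have hg : Differentiable ℂ g := by
      rw [← differentiableOn_univ] at hf ⊢
      exact (Complex.differentiableOn_dslope Filter.univ_mem).2 hf
    have hfg : ∀ z, f z = (z - a) * g z := fun z => by
      have := sub_smul_dslope f a z
      rw [ha, sub_zero, smul_eq_mul] at this
      exact this.symm
    have hgc := hg.continuous
    have hd : Dense ({a}ᶜ : Set ℂ) := dense_compl_singleton a
    -- Divide by `(z-a)(w-a)` off `a`, then extend by density, first in `w` and next in `z`.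
    have hgg1 : ∀ z, z ≠ a → ∀ w, g z * g w = -B (z + w) := fun z hz => by
      have : Set.EqOn (fun w => g z * g w) (fun w => -B (z + w)) {a}ᶜ := fun w hw => by
        have h1 := hprod z w
        rw [hfg z, hfg w] at h1
        have h2 : (z - a) * (w - a) ≠ 0 := mul_ne_zero (sub_ne_zero.2 hz) (sub_ne_zero.2 hw)
        apply mul_left_cancel₀ h2
        linear_combination h1
      exact congrFun (Continuous.ext_on hd (by fun_prop) (by fun_prop) this)
    have hgg : ∀ w z, g z * g w = -B (z + w) := fun w =>
      congrFun (Continuous.ext_on hd (f := fun z => g z * g w) (g := fun z => -B (z + w))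
        (by fun_prop) (by fun_prop) fun z hz => hgg1 z hz w)
    obtain ⟨C, β, hC⟩ := eq_exp_of_mul_eq hg (fun z w => by rw [hgg, hgg, add_zero]) (by
      obtain ⟨z, hz⟩ := hne
      exact ⟨z, fun h0 => hz (by rw [hfg, h0, mul_zero])⟩)
    exact ⟨C, -(C * a), β, fun z => by rw [hfg, hC]; ring⟩
  · push Not at hz
    -- Otherwise the quadratic in `x` has a complex root, which forces a zero of `f`.
    have hB0 : ∀ s, B s = 0 := fun s => by
      by_contra hs
      obtain ⟨x, hx⟩ := IsAlgClosed.exists_pow_nat_eq (-fiber f s 0 / B s) two_pos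
      have h1 := h s x
      rw [hx] at h1
      have h2 : fiber f s x = 0 := by
        rw [h1]
        change fiber f s 0 + B s * (-fiber f s 0 / B s) = 0
        field_simp
        ring
      exact mul_ne_zero (hz _) (hz _) h2
    obtain ⟨C, β, hC⟩ := eq_exp_of_mul_eq hf (fun z w => by
      rw [hzw, hzw, hB0, hB0, add_zero]
      ring) hne
    exact ⟨0, C, β, fun z => by rw [hC]; ring⟩

/-! ### Gaussian moments of affine functions. -/

theorem integral_eq_zero_of_rotate_neg (θ : ℝ) {E : Type*} [NormedAddCommGroup E]
    [NormedSpace ℝ E] {F : ℂ → E} (h : ∀ y, F (Complex.exp (θ * Complex.I) * y) = -F y) :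
    ∫ y, F y = 0 := by
  have h1 : ∫ y, F (Complex.exp (θ * Complex.I) * y) = ∫ y, F y :=
    ((rotation (Circle.exp θ)).measurePreserving).integral_comp
      (rotation (Circle.exp θ)).toHomeomorph.measurableEmbedding F
  simp_rw [h] at h1
  rw [integral_neg, neg_eq_iff_add_eq_zero, ← two_smul ℝ] at h1
  exact (smul_eq_zero.1 h1).resolve_left two_ne_zero

theorem integral_eq_zero_of_odd {E : Type*} [NormedAddCommGroup E]
    [NormedSpace ℝ E] {F : ℂ → E} (h : ∀ y, F (-y) = -F y) : ∫ y, F y = 0 :=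
  integral_eq_zero_of_rotate_neg Real.pi fun y => by
    rw [Complex.exp_pi_mul_I, neg_one_mul, h]

theorem integral_eq_zero_of_mul_I {E : Type*} [NormedAddCommGroup E]
    [NormedSpace ℝ E] {F : ℂ → E} (h : ∀ y, F (Complex.I * y) = -F y) : ∫ y, F y = 0 :=
  integral_eq_zero_of_rotate_neg (Real.pi / 2) fun y => by
    rw [show ((Real.pi / 2 : ℝ) : ℂ) = Real.pi / 2 by push_cast; rfl,
      Complex.exp_pi_div_two_mul_I, h]

theorem integrable_of_le_gaussian {E : Type*} [NormedAddCommGroup E]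
    {F : ℂ → E} (hF : Continuous F) (C : ℝ)
    (h : ∀ y, ‖F y‖ ≤ C * ((1 + ‖y‖ ^ 2) ^ 2 * Real.exp (-1 * ‖y‖ ^ 2))) : Integrable F := by
  have h0 := integrable_norm_pow_mul_exp one_pos 0
  have h1 := integrable_norm_pow_mul_exp one_pos 1
  have h2 := integrable_norm_pow_mul_exp one_pos 2
  have := ((h0.add (h1.const_mul 2)).add h2).const_mul C
  refine this.mono' hF.aestronglyMeasurable (Filter.Eventually.of_forall fun y => (h y).trans
    (le_of_eq ?_))
  simp only [Pi.add_apply]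
  ring

/-- A Gaussian times an affine function, centred at the origin. -/
def affineGaussian (p d y : ℂ) : ℝ := ‖p * y + d‖ ^ 2 * Real.exp (-1 * ‖y‖ ^ 2)

theorem continuous_affineGaussian (p d : ℂ) : Continuous (affineGaussian p d) := by
  unfold affineGaussian
  fun_prop

theorem norm_affine_sq_le (p d y : ℂ) :
    ‖p * y + d‖ ^ 2 ≤ 2 * (‖p‖ ^ 2 + ‖d‖ ^ 2) * (1 + ‖y‖ ^ 2) := by
  have h1 : ‖p * y + d‖ ≤ ‖p‖ * ‖y‖ + ‖d‖ := (norm_add_le _ _).trans (by rw [norm_mul])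
  have h2 : ‖p * y + d‖ ^ 2 ≤ (‖p‖ * ‖y‖ + ‖d‖) ^ 2 := by gcongr
  nlinarith [sq_nonneg (‖p‖ * ‖y‖ - ‖d‖), sq_nonneg ‖p‖, mul_nonneg (sq_nonneg ‖d‖) (sq_nonneg ‖y‖)]

theorem integrable_affineGaussian (p d : ℂ) : Integrable (affineGaussian p d) := by
  refine integrable_of_le_gaussian (continuous_affineGaussian p d) (2 * (‖p‖ ^ 2 + ‖d‖ ^ 2))
    fun y => ?_
  rw [affineGaussian, Real.norm_of_nonneg (by positivity), ← mul_assoc]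
  gcongr
  refine (norm_affine_sq_le p d y).trans ?_
  gcongr
  nlinarith [sq_nonneg ‖y‖]

theorem integrable_norm_sq_mul_affineGaussian (p d c : ℂ) :
    Integrable fun y => ‖y + c‖ ^ 2 * affineGaussian p d y := by
  have := continuous_affineGaussian p d
  refine integrable_of_le_gaussian (by fun_prop)
    ((2 * (‖(1 : ℂ)‖ ^ 2 + ‖c‖ ^ 2)) * (2 * (‖p‖ ^ 2 + ‖d‖ ^ 2))) fun y => ?_
  rw [affineGaussian, Real.norm_of_nonneg (by positivity)]
  have h1 := norm_affine_sq_le 1 c y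
  rw [one_mul] at h1
  calc _ ≤ (2 * (‖(1 : ℂ)‖ ^ 2 + ‖c‖ ^ 2) * (1 + ‖y‖ ^ 2)) *
        ((2 * (‖p‖ ^ 2 + ‖d‖ ^ 2) * (1 + ‖y‖ ^ 2)) * Real.exp (-1 * ‖y‖ ^ 2)) := by
        gcongr
        exact norm_affine_sq_le p d y
    _ = _ := by ring

theorem affineGaussian_eq (p d y : ℂ) : affineGaussian p d y =
    (‖p‖ ^ 2 * (Real.exp (-1 * ‖y‖ ^ 2) * ‖y‖ ^ (2 * 1)) +
      ‖d‖ ^ 2 * (Real.exp (-1 * ‖y‖ ^ 2) * ‖y‖ ^ (2 * 0))) +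
      2 * (p * y * (starRingEnd ℂ) d).re * Real.exp (-1 * ‖y‖ ^ 2) := by
  have : ‖p * y + d‖ ^ 2 = ‖p‖ ^ 2 * ‖y‖ ^ 2 + ‖d‖ ^ 2 + 2 * (p * y * (starRingEnd ℂ) d).re := by
    rw [← mul_pow, ← norm_mul]
    simp only [← Complex.normSq_eq_norm_sq]
    exact Complex.normSq_add _ _
  rw [affineGaussian, this]
  ring

theorem integral_affineGaussian (p d : ℂ) :
    ∫ y, affineGaussian p d y = Real.pi * (‖p‖ ^ 2 + ‖d‖ ^ 2) := by
  have h0 := (integrable_norm_pow_mul_exp one_pos 0).const_mul (‖d‖ ^ 2)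
  have h1 := (integrable_norm_pow_mul_exp one_pos 1).const_mul (‖p‖ ^ 2)
  have h2 : Integrable fun y : ℂ =>
      2 * (p * y * (starRingEnd ℂ) d).re * Real.exp (-1 * ‖y‖ ^ 2) := by
    refine ((integrable_affineGaussian p d).sub (h1.add h0)).congr
      (Filter.Eventually.of_forall fun y => ?_)
    simp only [Pi.sub_apply, Pi.add_apply, affineGaussian_eq]
    ring
  simp_rw [affineGaussian_eq]
  rw [integral_add (by exact h1.add h0) h2, integral_add h1 h0, integral_const_mul,
    integral_const_mul, integral_norm_pow_mul_exp one_pos, integral_norm_pow_mul_exp one_pos,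
    integral_eq_zero_of_odd (F := fun y : ℂ =>
      2 * (p * y * (starRingEnd ℂ) d).re * Real.exp (-1 * ‖y‖ ^ 2)) (fun y => by
        simp only [mul_neg, neg_mul, Complex.neg_re, norm_neg])]
  simp
  ring

theorem integral_mul_affineGaussian (p d c : ℂ) :
    ∫ y, (y + c) * (affineGaussian p d y : ℂ) =
      Real.pi * (c * (‖p‖ ^ 2 + ‖d‖ ^ 2 : ℝ) + (starRingEnd ℂ) p * d) := by
  -- Sort by angular dependence: the multiple of `y` dies under `y ↦ -y`, that of `y²` under `y ↦
  -- iy`, and only the radial part of the cross term survives.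
  have e : ∀ y, (y + c) * (affineGaussian p d y : ℂ) =
      c * (affineGaussian p d y : ℂ) +
        (y * ((‖p‖ ^ 2 * ‖y‖ ^ 2 + ‖d‖ ^ 2) * Real.exp (-1 * ‖y‖ ^ 2) : ℝ) +
        (p * (starRingEnd ℂ) d * (y ^ 2 * (Real.exp (-1 * ‖y‖ ^ 2) : ℝ)) +
          (starRingEnd ℂ) p * d * ((Real.exp (-1 * ‖y‖ ^ 2) * ‖y‖ ^ (2 * 1) : ℝ) : ℂ))) := fun y => by
    have h1 : ((2 * (p * y * (starRingEnd ℂ) d).re : ℝ) : ℂ) =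
        p * y * (starRingEnd ℂ) d + (starRingEnd ℂ) p * (starRingEnd ℂ) y * d := by
      rw [← Complex.add_conj]
      simp
    have h2 : y * (starRingEnd ℂ) y = ((‖y‖ ^ 2 : ℝ) : ℂ) := by
      rw [Complex.mul_conj, Complex.normSq_eq_norm_sq]
    rw [add_mul, add_comm, affineGaussian_eq]
    congr 1
    rw [Complex.ofReal_add, Complex.ofReal_mul (2 * _), h1]
    push_cast at h2 ⊢
    linear_combination ((starRingEnd ℂ) p * d * Complex.exp (-1 * (‖y‖ : ℂ) ^ 2)) * h2
  have i1 : Integrable fun y => c * (affineGaussian p d y : ℂ) :=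
    (integrable_affineGaussian p d).ofReal.const_mul c
  have i2 : Integrable fun y : ℂ =>
      y * ((‖p‖ ^ 2 * ‖y‖ ^ 2 + ‖d‖ ^ 2) * Real.exp (-1 * ‖y‖ ^ 2) : ℝ) := by
    refine integrable_of_le_gaussian (by fun_prop) (‖p‖ ^ 2 + ‖d‖ ^ 2) fun y => ?_
    rw [norm_mul, Complex.norm_real, Real.norm_of_nonneg (by positivity)]
    have h1 : ‖y‖ ≤ 1 + ‖y‖ ^ 2 := by nlinarith [sq_nonneg (‖y‖ - 1), sq_nonneg ‖y‖]
    calc ‖y‖ * ((‖p‖ ^ 2 * ‖y‖ ^ 2 + ‖d‖ ^ 2) * Real.exp (-1 * ‖y‖ ^ 2))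
        ≤ (1 + ‖y‖ ^ 2) * (((‖p‖ ^ 2 + ‖d‖ ^ 2) * (1 + ‖y‖ ^ 2)) *
            Real.exp (-1 * ‖y‖ ^ 2)) := by
          gcongr
          nlinarith [sq_nonneg ‖p‖, mul_nonneg (sq_nonneg ‖d‖) (sq_nonneg ‖y‖)]
      _ = _ := by ring
  have i3 : Integrable fun y : ℂ => y ^ 2 * ((Real.exp (-1 * ‖y‖ ^ 2) : ℝ) : ℂ) := by
    refine integrable_of_le_gaussian (by fun_prop) 1 fun y => ?_
    rw [norm_mul, Complex.norm_real, Real.norm_of_nonneg (by positivity), norm_pow, one_mul]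
    gcongr
    nlinarith [sq_nonneg ‖y‖, sq_nonneg (‖y‖ ^ 2)]
  have i4 : Integrable fun y : ℂ => ((Real.exp (-1 * ‖y‖ ^ 2) * ‖y‖ ^ (2 * 1) : ℝ) : ℂ) :=
    (integrable_norm_pow_mul_exp one_pos 1).ofReal
  have i34 := (i3.const_mul (p * (starRingEnd ℂ) d)).add (i4.const_mul ((starRingEnd ℂ) p * d))
  simp_rw [e]
  rw [integral_add i1 (by exact i2.add i34), integral_add i2 (by exact i34),
    integral_add (i3.const_mul _) (i4.const_mul _), integral_const_mul, integral_const_mul,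
    integral_const_mul, integral_complex_ofReal, integral_complex_ofReal, integral_affineGaussian,
    integral_norm_pow_mul_exp one_pos, integral_eq_zero_of_odd (F := fun y : ℂ =>
      y * ((‖p‖ ^ 2 * ‖y‖ ^ 2 + ‖d‖ ^ 2) * Real.exp (-1 * ‖y‖ ^ 2) : ℝ)) (fun y => by simp),
    integral_eq_zero_of_mul_I (F := fun y : ℂ =>
      y ^ 2 * ((Real.exp (-1 * ‖y‖ ^ 2) : ℝ) : ℂ)) (fun y => by simp [mul_pow])]
  simp
  ring

/-! ### Mass and momentum of the candidate profiles. -/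

/-- An affine function times an exponential, with the Gaussian weight. -/
def profile (p q β z : ℂ) : ℂ :=
  ((Real.exp (-‖z‖ ^ 2 / 2) : ℝ) : ℂ) * ((p * z + q) * Complex.exp (β * z))

/-- The value of the affine factor of `profile p q β` at the centre `conj β` of its Gaussian. -/
def recentred (p q β : ℂ) : ℂ := p * (starRingEnd ℂ) β + q

/-- Complete the square: `-|z|² + 2 Re(βz) = |β|² - |z - β̄|²`. -/
theorem norm_profile_sq (p q β z : ℂ) : ‖profile p q β z‖ ^ 2 =
    Real.exp (‖β‖ ^ 2) * affineGaussian p (recentred p q β) (z - (starRingEnd ℂ) β) := by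
  have h1 : p * (z - (starRingEnd ℂ) β) + recentred p q β = p * z + q := by
    rw [recentred]; ring
  have h3 : ((2 : ℕ) : ℝ) * (-‖z‖ ^ 2 / 2) + ((2 : ℕ) : ℝ) * (β * z).re = ‖β‖ ^ 2 + -1 * ‖z - (starRingEnd ℂ) β‖ ^ 2 := by
    simp only [← Complex.normSq_eq_norm_sq, Complex.normSq_apply, Complex.mul_re, Complex.sub_re,
      Complex.sub_im, Complex.conj_re, Complex.conj_im]
    push_cast
    ring
  rw [affineGaussian, h1, profile, norm_mul, norm_mul, Complex.norm_exp, Complex.norm_real,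
    Real.norm_of_nonneg (Real.exp_pos _).le, mul_pow, mul_pow, ← Real.exp_nat_mul,
    ← Real.exp_nat_mul, mul_left_comm (Real.exp _), ← Real.exp_add, h3, Real.exp_add]
  ring

theorem profile_differentiable (p q β : ℂ) :
    Differentiable ℂ fun z => (p * z + q) * Complex.exp (β * z) := by
  fun_prop

theorem continuous_profile (p q β : ℂ) : Continuous (profile p q β) := by
  unfold profile
  fun_prop

theorem integrable_profile_sq (p q β : ℂ) : Integrable fun z => ‖profile p q β z‖ ^ 2 := by
  simp_rw [norm_profile_sq]
  exact ((integrable_affineGaussian p (recentred p q β)).comp_sub_right _).const_mul _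

theorem integrable_sq_mul_profile_sq (p q β : ℂ) :
    Integrable fun z => ‖z‖ ^ 2 * ‖profile p q β z‖ ^ 2 := by
  simp_rw [norm_profile_sq]
  refine (((integrable_norm_sq_mul_affineGaussian p (recentred p q β)
    ((starRingEnd ℂ) β)).comp_sub_right ((starRingEnd ℂ) β)).const_mul
      (Real.exp (‖β‖ ^ 2))).congr (Filter.Eventually.of_forall fun z => ?_)
  simp only [sub_add_cancel]
  ring

theorem mass_profile (p q β : ℂ) : mass (profile p q β) =
    Real.exp (‖β‖ ^ 2) * (Real.pi * (‖p‖ ^ 2 + ‖recentred p q β‖ ^ 2)) := by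
  rw [mass]
  simp_rw [norm_profile_sq]
  rw [integral_const_mul, integral_sub_right_eq_self, integral_affineGaussian]

/-- The (conjugate) magnetic momentum `∫ z |u|^2`. -/
def magneticMomentum (u : ℂ → ℂ) : ℂ := ∫ z, z * ((‖u z‖ ^ 2 : ℝ) : ℂ)

theorem magneticMomentum_profile (p q β : ℂ) : magneticMomentum (profile p q β) =
    Real.exp (‖β‖ ^ 2) * (Real.pi * ((starRingEnd ℂ) β *
      (‖p‖ ^ 2 + ‖recentred p q β‖ ^ 2 : ℝ) + (starRingEnd ℂ) p * recentred p q β)) := by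
  rw [magneticMomentum, ← integral_mul_affineGaussian, ← integral_const_mul,
    ← integral_sub_right_eq_self (fun y => ((Real.exp (‖β‖ ^ 2) : ℝ) : ℂ) *
      ((y + (starRingEnd ℂ) β) * (affineGaussian p (recentred p q β) y : ℂ)))
      ((starRingEnd ℂ) β)]
  congr 1; ext z
  rw [norm_profile_sq, sub_add_cancel, Complex.ofReal_mul]
  ring

theorem profile_mem_bargmannFock (p q β : ℂ) : profile p q β ∈ bargmannFock :=
  ⟨⟨_, profile_differentiable p q β, fun _ => rfl⟩,
    (memLp_two_iff_integrable_sq_norm (continuous_profile p q β).aestronglyMeasurable).2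
      (integrable_profile_sq p q β)⟩

/-! ### The sharp lower bound and its equality case. -/

theorem integrable_sq_of_mem {u : ℂ → ℂ} (hu : u ∈ bargmannFock) :
    Integrable fun z => ‖u z‖ ^ 2 :=
  (memLp_two_iff_integrable_sq_norm hu.2.1).1 hu.2

theorem energy_half_eq_top {u : ℂ → ℂ} (hu : u ∈ bargmannFock)
    (h : ¬ Integrable fun z => ‖z‖ ^ 2 * ‖u z‖ ^ 2) : energy (1 / 2) u = ⊤ := by
  have h' : ¬ Integrable fun z : ℂ => (‖z‖ ^ 2 - 1) * ‖u z‖ ^ 2 := fun hi => h <| by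
    refine (hi.add (integrable_sq_of_mem hu)).congr (Filter.Eventually.of_forall fun z => ?_)
    simp only [Pi.add_apply]
    ring
  rw [energy, angularMomentum, if_neg h', EReal.coe_mul_top_of_pos (by norm_num),
    EReal.coe_add_top]

theorem energy_half_eq {u f : ℂ → ℂ}
    (hu : ∀ z, u z = ((Real.exp (-‖z‖ ^ 2 / 2) : ℝ) : ℂ) * f z) (hf : Differentiable ℂ f)
    (hi : Integrable fun z => ‖u z‖ ^ 2) (hi2 : Integrable fun z => ‖z‖ ^ 2 * ‖u z‖ ^ 2)
    (hm : mass u = 1) :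
    energy (1 / 2) u = ((1 + 1 / 2 * ‖magneticMomentum u‖ ^ 2 +
      ∫ s, Real.exp (-‖s‖ ^ 2 / 2) * fiberDefect (fiber f s) : ℝ) : EReal) := by
  have e : ∀ z, (‖z‖ ^ 2 - 1) * ‖u z‖ ^ 2 = ‖z‖ ^ 2 * ‖u z‖ ^ 2 - ‖u z‖ ^ 2 := fun z => by ring
  have hm' : ∫ z, ‖u z‖ ^ 2 = 1 := hm
  have hI : Integrable fun z => (‖z‖ ^ 2 - 1) * ‖u z‖ ^ 2 := by
    simp_rw [e]
    exact hi2.sub hi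
  rw [energy, angularMomentum, if_pos hI]
  simp_rw [e]
  rw [integral_sub hi2 hi, ← EReal.coe_mul, ← EReal.coe_add,
    (hasIntegral_fiberDefect hu hf hi hi2).2, hm', magneticMomentum, hamiltonian]
  congr 1
  ring

theorem integral_fiberDefect_nonneg {u f : ℂ → ℂ}
    (hu : ∀ z, u z = ((Real.exp (-‖z‖ ^ 2 / 2) : ℝ) : ℂ) * f z) (hf : Differentiable ℂ f)
    (hi : Integrable fun z => ‖u z‖ ^ 2) (hi2 : Integrable fun z => ‖z‖ ^ 2 * ‖u z‖ ^ 2) :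
    0 ≤ ∫ s, Real.exp (-‖s‖ ^ 2 / 2) * fiberDefect (fiber f s) :=
  integral_nonneg_of_ae (ae_fiberDefect_nonneg hu hf hi hi2)

theorem one_le_energy_half {u : ℂ → ℂ} (hu : u ∈ unitMass) : 1 ≤ energy (1 / 2) u := by
  by_cases hi2 : Integrable fun z => ‖z‖ ^ 2 * ‖u z‖ ^ 2
  · obtain ⟨⟨⟨f, hf, huf⟩, -⟩, hm⟩ := id hu
    have hi := integrable_sq_of_mem hu.1
    rw [energy_half_eq huf hf hi hi2 hm]
    have := integral_fiberDefect_nonneg huf hf hi hi2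
    have h2 : 0 ≤ 1 / 2 * ‖magneticMomentum u‖ ^ 2 := by positivity
    exact_mod_cast (by linarith : (1 : ℝ) ≤ _)
  · rw [energy_half_eq_top hu.1 hi2]
    exact le_top

/-- The fibre of `(pz + q)e^{βz}` is `((ps/2 + q)² - p²x²)e^{βs}`, so its defect vanishes. -/
theorem energy_half_profile {p q β : ℂ} (hm : mass (profile p q β) = 1)
    (hQ : magneticMomentum (profile p q β) = 0) : energy (1 / 2) (profile p q β) = 1 := by
  rw [energy_half_eq (u := profile p q β) (fun _ => rfl) (profile_differentiable p q β) (integrable_profile_sq p q β)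
    (integrable_sq_mul_profile_sq p q β) hm, hQ, integral_fiberDefect_eq_zero (u := profile p q β)
    (fun _ => rfl) (integrable_profile_sq p q β) (integrable_sq_mul_profile_sq p q β)
    (fun s => (p * (s / 2) + q) ^ 2 * Complex.exp (β * s)) (fun s => -p ^ 2 * Complex.exp (β * s))]
  · simp
  · intro s x
    have : Complex.exp (β * s) =
        Complex.exp (β * (s / 2 + x)) * Complex.exp (β * (s / 2 - x)) := by
      rw [← Complex.exp_add]
      ring_nf
    rw [fiber, this]
    ring

theorem isGlobalMinimizer_half_iff (u : ℂ → ℂ) : IsGlobalMinimizer (1 / 2) u ↔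
    ∃ p q β : ℂ, mass (profile p q β) = 1 ∧ magneticMomentum (profile p q β) = 0 ∧
      u = profile p q β := by
  constructor
  · rintro ⟨hu, hmin⟩
    -- The Gaussian `φ₀` is the competitor showing that the bound 1 is attained.
    have hm0 : mass (profile 0 ((1 / Real.sqrt Real.pi : ℝ) : ℂ) 0) = 1 := by
      rw [mass_profile, recentred]
      simp only [zero_mul, zero_add, Complex.norm_real, norm_zero, Real.norm_eq_abs, sq_abs,
        div_pow, Real.sq_sqrt Real.pi_pos.le]
      have := Real.pi_ne_zero
      norm_num [this]
    have hQ0 : magneticMomentum (profile 0 ((1 / Real.sqrt Real.pi : ℝ) : ℂ) 0) = 0 := by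
      rw [magneticMomentum_profile]
      simp
    have hle := hmin _ ⟨profile_mem_bargmannFock _ _ _, hm0⟩
    rw [energy_half_profile hm0 hQ0] at hle
    have hi2 : Integrable fun z => ‖z‖ ^ 2 * ‖u z‖ ^ 2 := by
      by_contra h
      rw [energy_half_eq_top hu.1 h] at hle
      exact absurd (top_le_iff.1 hle) (EReal.coe_ne_top 1)
    have hi := integrable_sq_of_mem hu.1
    obtain ⟨⟨⟨f, hf, huf⟩, -⟩, hm⟩ := hu
    rw [energy_half_eq huf hf hi hi2 hm] at hle
    have hle' : 1 + 1 / 2 * ‖magneticMomentum u‖ ^ 2 +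
      ∫ s, Real.exp (-‖s‖ ^ 2 / 2) * fiberDefect (fiber f s) ≤ 1 := by exact_mod_cast hle
    have hD := integral_fiberDefect_nonneg huf hf hi hi2
    have hQ : 0 ≤ ‖magneticMomentum u‖ ^ 2 := by positivity
    have hne : ∃ z, f z ≠ 0 := by
      by_contra! h
      have : mass u = 0 := by simp [mass, huf, h]
      linarith
    obtain ⟨p, q, β, h⟩ := eq_affine_mul_exp_of_fiber hf hne
      (fiber_quadratic huf hf hi hi2 (by linarith))
    have hup : u = profile p q β := funext fun z => by rw [huf, h, profile]
    refine ⟨p, q, β, hup ▸ hm, hup ▸ ?_, hup⟩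
    have : ‖magneticMomentum u‖ ^ 2 = 0 := by linarith
    simpa using this
  · rintro ⟨p, q, β, hm, hQ, rfl⟩
    refine ⟨⟨profile_mem_bargmannFock p q β, hm⟩, fun v hv => ?_⟩
    rw [energy_half_profile hm hQ]
    exact one_le_energy_half hv

/-! ### Matching the profiles with the explicit functions. -/

theorem exists_real_angle (w : ℂ) : ∃ γ : ℝ, w = ‖w‖ * Complex.exp (Complex.I * γ) :=
  ⟨w.arg, by rw [mul_comm Complex.I, Complex.norm_mul_exp_arg_mul_I]⟩

theorem phi0_eq (γ θ : ℝ) : phaseRotation γ (spaceRotation θ phi0) =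
    profile 0 (Complex.exp (Complex.I * γ) * ((1 / Real.sqrt Real.pi : ℝ) : ℂ)) 0 := by
  ext z
  have : ‖Complex.exp (Complex.I * θ)‖ = 1 := by rw [mul_comm, Complex.norm_exp_ofReal_mul_I]
  simp only [phaseRotation, spaceRotation, phi0, profile, norm_mul, this, one_mul, zero_mul,
    zero_add, Complex.exp_zero]
  ring

/-- The modulus of the leading coefficient of `ψ_b`. -/
def psiCoeff (b : ℝ) : ℝ :=
  Real.exp (-(1 / 2) * (b / (1 + b ^ 2)) ^ 2) / Real.sqrt (Real.pi * (1 + b ^ 2))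

theorem psiCoeff_pos (b : ℝ) : 0 < psiCoeff b := by
  have := Real.pi_pos
  unfold psiCoeff
  positivity

theorem psiCoeff_sq (b : ℝ) :
    Real.exp ((b / (1 + b ^ 2)) ^ 2) * (Real.pi * (psiCoeff b ^ 2 * (1 + b ^ 2))) = 1 := by
  have h1 : (0 : ℝ) < 1 + b ^ 2 := by positivity
  have hp := Real.pi_pos
  rw [psiCoeff, div_pow (Real.exp _), Real.sq_sqrt (by positivity), ← Real.exp_nat_mul]
  have h2 : Real.exp ((b / (1 + b ^ 2)) ^ 2) *
      Real.exp ((2 : ℕ) * (-(1 / 2) * (b / (1 + b ^ 2)) ^ 2)) = 1 := by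
    rw [← Real.exp_add, Real.exp_eq_one_iff]
    push_cast
    ring
  generalize Real.exp ((b / (1 + b ^ 2)) ^ 2) = x at h2 ⊢
  generalize Real.exp ((2 : ℕ) * (-(1 / 2) * (b / (1 + b ^ 2)) ^ 2)) = y at h2 ⊢
  field_simp
  exact h2

theorem psi_eq (b γ θ : ℝ) : phaseRotation γ (spaceRotation θ (psi b)) =
    profile (Complex.exp (Complex.I * γ) * psiCoeff b * Complex.exp (Complex.I * θ))
      (-(Complex.exp (Complex.I * γ) * psiCoeff b * ((b * (2 + b ^ 2) / (1 + b ^ 2) : ℝ) : ℂ)))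
      (((b / (1 + b ^ 2) : ℝ) : ℂ) * Complex.exp (Complex.I * θ)) := by
  ext z
  have : ‖Complex.exp (Complex.I * θ)‖ = 1 := by rw [mul_comm, Complex.norm_exp_ofReal_mul_I]
  simp only [phaseRotation, spaceRotation, psi, profile, norm_mul, this, one_mul]
  rw [sub_eq_add_neg (((b / (1 + b ^ 2) : ℝ) : ℂ) * _), Complex.exp_add,
    show -((‖z‖ ^ 2 / 2 : ℝ) : ℂ) = ((-‖z‖ ^ 2 / 2 : ℝ) : ℂ) by push_cast; ring,
    ← Complex.ofReal_exp, ← psiCoeff, mul_assoc (((b / (1 + b ^ 2) : ℝ) : ℂ))]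
  ring

theorem phi1_eq_psi : phi1 = psi 0 := by
  ext z
  have : psiCoeff 0 = 1 / Real.sqrt Real.pi := by simp [psiCoeff]
  rw [phi1, psi, ← psiCoeff, this, Complex.ofReal_exp]
  simp [neg_div]

theorem mass_and_momentum_phi0 (γ : ℝ) :
    let u := profile 0 (Complex.exp (Complex.I * γ) * ((1 / Real.sqrt Real.pi : ℝ) : ℂ)) 0
    mass u = 1 ∧ magneticMomentum u = 0 := by
  have : ‖Complex.exp (Complex.I * γ)‖ = 1 := by rw [mul_comm, Complex.norm_exp_ofReal_mul_I]
  constructor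
  · rw [mass_profile, recentred]
    simp only [zero_mul, zero_add, Complex.norm_real, norm_zero, Real.norm_eq_abs, norm_mul, this,
      mul_pow, sq_abs, div_pow, Real.sq_sqrt Real.pi_pos.le]
    have := Real.pi_ne_zero
    norm_num [this]
  · rw [magneticMomentum_profile]
    simp

theorem mass_and_momentum_psi (b γ θ : ℝ) :
    let u := profile (Complex.exp (Complex.I * γ) * psiCoeff b * Complex.exp (Complex.I * θ))
      (-(Complex.exp (Complex.I * γ) * psiCoeff b * ((b * (2 + b ^ 2) / (1 + b ^ 2) : ℝ) : ℂ)))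
      (((b / (1 + b ^ 2) : ℝ) : ℂ) * Complex.exp (Complex.I * θ))
    mass u = 1 ∧ magneticMomentum u = 0 := by
  have hn : ∀ t : ℝ, ‖Complex.exp (Complex.I * t)‖ = 1 := fun t => by
    rw [mul_comm, Complex.norm_exp_ofReal_mul_I]
  have hc : ∀ t : ℝ, Complex.exp (Complex.I * t) * (starRingEnd ℂ) (Complex.exp (Complex.I * t)) =
      1 := fun t => by rw [Complex.mul_conj, Complex.normSq_eq_norm_sq, hn]; simp
  have hb : (1 + b ^ 2 : ℝ) ≠ 0 := by positivity
  have hb' : (1 + (b : ℂ) ^ 2) ≠ 0 := by exact_mod_cast hb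
  have hr : recentred (Complex.exp (Complex.I * γ) * psiCoeff b * Complex.exp (Complex.I * θ))
      (-(Complex.exp (Complex.I * γ) * psiCoeff b * ((b * (2 + b ^ 2) / (1 + b ^ 2) : ℝ) : ℂ)))
      (((b / (1 + b ^ 2) : ℝ) : ℂ) * Complex.exp (Complex.I * θ)) =
      -(Complex.exp (Complex.I * γ) * psiCoeff b * b) := by
    rw [recentred, map_mul, Complex.conj_ofReal]
    have h1 : ((b / (1 + b ^ 2) : ℝ) : ℂ) - ((b * (2 + b ^ 2) / (1 + b ^ 2) : ℝ) : ℂ) = -b := by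
      push_cast
      field_simp
      ring
    linear_combination (Complex.exp (Complex.I * γ) * psiCoeff b * ((b / (1 + b ^ 2) : ℝ) : ℂ)) *
      hc θ + (Complex.exp (Complex.I * γ) * psiCoeff b) * h1
  constructor
  · rw [mass_profile, hr]
    simp only [norm_neg, norm_mul, hn, Complex.norm_real, Real.norm_eq_abs, mul_pow, sq_abs, one_pow, mul_one]
    linear_combination psiCoeff_sq b
  · rw [magneticMomentum_profile, hr]
    have h2 : (starRingEnd ℂ) (((b / (1 + b ^ 2) : ℝ) : ℂ) * Complex.exp (Complex.I * θ)) *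
        (‖Complex.exp (Complex.I * γ) * psiCoeff b * Complex.exp (Complex.I * θ)‖ ^ 2 +
          ‖-(Complex.exp (Complex.I * γ) * psiCoeff b * b)‖ ^ 2 : ℝ) +
        (starRingEnd ℂ) (Complex.exp (Complex.I * γ) * psiCoeff b * Complex.exp (Complex.I * θ)) *
          -(Complex.exp (Complex.I * γ) * psiCoeff b * b) = 0 := by
      simp only [norm_neg, norm_mul, hn, Complex.norm_real, Real.norm_eq_abs, mul_pow, sq_abs,
        map_mul, Complex.conj_ofReal]
      have h3 : ((b / (1 + b ^ 2) : ℝ) : ℂ) * (1 + (b : ℂ) ^ 2) = b := by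
        push_cast
        field_simp
      push_cast at h3 ⊢
      linear_combination ((starRingEnd ℂ) (Complex.exp (Complex.I * θ)) * (psiCoeff b : ℂ) ^ 2) *
        h3 - ((starRingEnd ℂ) (Complex.exp (Complex.I * θ)) * (psiCoeff b : ℂ) ^ 2 * b) * hc γ
    rw [h2, mul_zero, mul_zero]

/-- Zero momentum reads `β̄(|p|² + |d|²) = -p̄d`, so `β` is determined by `d/p`. The modulus of
`d/p` is `b`, its argument gives `θ`, the mass fixes `|p|`, and the argument of `p` gives `γ`. -/
theorem exists_psi_of_profile {p q β : ℂ} (hp : p ≠ 0) (hm : mass (profile p q β) = 1)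
    (hQ : magneticMomentum (profile p q β) = 0) :
    ∃ b : ℝ, 0 ≤ b ∧ ∃ γ θ : ℝ,
      profile p q β = phaseRotation γ (spaceRotation θ (psi b)) := by
  set d := recentred p q β with hd
  set b : ℝ := ‖d / p‖ with hb
  -- The sign and conjugate are chosen so that `d = -b e^{-iθ'} p`, hence `β = b/(1+b²) e^{iθ'}`.
  obtain ⟨θ', hθ'⟩ := exists_real_angle (-(starRingEnd ℂ) (d / p))
  rw [norm_neg, RCLike.norm_conj, ← hb] at hθ'
  obtain ⟨γ', hγ'⟩ := exists_real_angle p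
  have hn : ∀ t : ℝ, ‖Complex.exp (Complex.I * t)‖ = 1 := fun t => by
    rw [mul_comm, Complex.norm_exp_ofReal_mul_I]
  have hc : (starRingEnd ℂ) (Complex.exp (Complex.I * θ')) * Complex.exp (Complex.I * θ') =
      1 := by rw [mul_comm, Complex.mul_conj, Complex.normSq_eq_norm_sq, hn]; simp
  have hp0 : ‖p‖ ≠ 0 := norm_ne_zero_iff.2 hp
  have hdn : ‖d‖ = b * ‖p‖ := by rw [hb, norm_div]; field_simp
  have hdp : d = -(b * (starRingEnd ℂ) (Complex.exp (Complex.I * θ')) * p) := by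
    have := congrArg (starRingEnd ℂ) hθ'
    simp only [map_neg, Complex.conj_conj, map_mul, Complex.conj_ofReal] at this
    rw [← this]
    field_simp
  have hb1 : (1 + b ^ 2 : ℝ) ≠ 0 := by positivity
  have hb1' : (1 + (b : ℂ) ^ 2) ≠ 0 := by exact_mod_cast hb1
  have hpp : (starRingEnd ℂ) p * p = (‖p‖ : ℂ) ^ 2 := by
    rw [mul_comm, Complex.mul_conj, Complex.normSq_eq_norm_sq]; push_cast; rfl
  have hβ : β = ((b / (1 + b ^ 2) : ℝ) : ℂ) * Complex.exp (Complex.I * θ') := by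
    rw [magneticMomentum_profile, ← hd, hdn] at hQ
    have h1 : (starRingEnd ℂ) β * ((‖p‖ ^ 2 + (b * ‖p‖) ^ 2 : ℝ) : ℂ) +
        (starRingEnd ℂ) p * d = 0 := by
      simpa [Real.pi_ne_zero, Complex.exp_ne_zero] using hQ
    rw [hdp] at h1
    have h2 : (starRingEnd ℂ) β * (1 + (b : ℂ) ^ 2) =
        b * (starRingEnd ℂ) (Complex.exp (Complex.I * θ')) := by
      have hp2 : (‖p‖ : ℂ) ^ 2 ≠ 0 := by exact_mod_cast pow_ne_zero 2 hp0
      apply mul_left_cancel₀ hp2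
      push_cast at h1
      linear_combination h1 + b * (starRingEnd ℂ) (Complex.exp (Complex.I * θ')) * hpp
    have h3 := congrArg (starRingEnd ℂ) h2
    simp only [map_mul, Complex.conj_conj, map_add, map_one, map_pow, Complex.conj_ofReal] at h3
    push_cast
    field_simp
    exact h3
  have hβn : ‖β‖ ^ 2 = (b / (1 + b ^ 2)) ^ 2 := by
    rw [hβ, norm_mul, hn, Complex.norm_real, mul_one, Real.norm_eq_abs, sq_abs]
  have hpn : ‖p‖ = psiCoeff b := by
    rw [mass_profile, ← hd, hdn, hβn] at hm
    have h1 := psiCoeff_sq b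
    have h2 : ‖p‖ ^ 2 = psiCoeff b ^ 2 := by
      have he : Real.exp ((b / (1 + b ^ 2)) ^ 2) * (Real.pi * (1 + b ^ 2)) ≠ 0 :=
        mul_ne_zero (Real.exp_pos _).ne' (mul_ne_zero Real.pi_ne_zero hb1)
      apply mul_left_cancel₀ he
      linear_combination hm - h1
    exact (pow_left_inj₀ (norm_nonneg _) (psiCoeff_pos b).le two_ne_zero).1 h2
  -- The space rotation already multiplies the leading coefficient by `e^{iθ'}`, so the phase is
  -- corrected by `-θ'`.
  refine ⟨b, norm_nonneg _, γ' - θ', θ', ?_⟩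
  rw [psi_eq]
  have hexp : Complex.exp (Complex.I * ((γ' - θ' : ℝ) : ℂ)) =
      Complex.exp (Complex.I * γ') * (starRingEnd ℂ) (Complex.exp (Complex.I * θ')) := by
    rw [← Complex.exp_conj, ← Complex.exp_add]
    simp only [map_mul, Complex.conj_I, Complex.conj_ofReal]
    push_cast
    ring_nf
  have hpe : p = psiCoeff b * Complex.exp (Complex.I * γ') := hpn ▸ hγ'
  have h1 : Complex.exp (Complex.I * ((γ' - θ' : ℝ) : ℂ)) * psiCoeff b *
      Complex.exp (Complex.I * θ') = p := by
    rw [hexp]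
    linear_combination (Complex.exp (Complex.I * γ') * psiCoeff b) * hc - hpe
  have hβc : (starRingEnd ℂ) β =
      ((b / (1 + b ^ 2) : ℝ) : ℂ) * (starRingEnd ℂ) (Complex.exp (Complex.I * θ')) := by
    rw [hβ, map_mul, Complex.conj_ofReal]
  have h2 : -(Complex.exp (Complex.I * ((γ' - θ' : ℝ) : ℂ)) * psiCoeff b *
      ((b * (2 + b ^ 2) / (1 + b ^ 2) : ℝ) : ℂ)) = q := by
    have hq : q = d - p * (starRingEnd ℂ) β := by rw [hd, recentred]; ring
    -- The zero of `ψ_b` lies at distance `b` from its Gaussian centre `b/(1+b²)`.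
    have h3 : ((b * (2 + b ^ 2) / (1 + b ^ 2) : ℝ) : ℂ) = b + ((b / (1 + b ^ 2) : ℝ) : ℂ) := by
      push_cast
      field_simp
      ring
    rw [hq, hdp, hβc, h3, hexp]
    linear_combination ((b + ((b / (1 + b ^ 2) : ℝ) : ℂ)) *
      (starRingEnd ℂ) (Complex.exp (Complex.I * θ'))) * hpe
  rw [h1, h2, ← hβ]

/-- Without a linear term the momentum is a positive multiple of `β̄|q|²`, so `β = 0`. -/
theorem exists_phi0_of_profile {q β : ℂ} (hm : mass (profile 0 q β) = 1)
    (hQ : magneticMomentum (profile 0 q β) = 0) :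
    ∃ γ : ℝ, profile 0 q β = phaseRotation γ (spaceRotation 0 phi0) := by
  have hr : recentred 0 q β = q := by simp [recentred]
  rw [mass_profile, hr] at hm
  rw [magneticMomentum_profile, hr] at hQ
  have hq : q ≠ 0 := by
    rintro rfl
    simp at hm
  have hβ : β = 0 := by simpa [Real.pi_ne_zero, Complex.exp_ne_zero, hq] using hQ
  subst hβ
  obtain ⟨γ, hγ⟩ := exists_real_angle q
  have hn : ‖q‖ = 1 / Real.sqrt Real.pi := by
    rw [eq_div_iff (Real.sqrt_pos.2 Real.pi_pos).ne', ← Real.sqrt_sq (norm_nonneg q),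
      ← Real.sqrt_mul (by positivity), Real.sqrt_eq_one]
    simpa [mul_comm] using hm
  refine ⟨γ, ?_⟩
  rw [phi0_eq, ← hn, mul_comm, ← hγ]

end LLL

end

/-- At `μ = 1/2` the global minimizers are exactly the phase and space rotations of
`φ₀`, `φ₁` and `ψ_b`, `b ≥ 0`. -/
theorem theorem1p3 (u : ℂ → ℂ) :
    LLL.IsGlobalMinimizer (1 / 2) u ↔
      ∃ w : ℂ → ℂ, (w = LLL.phi0 ∨ w = LLL.phi1 ∨ ∃ b : ℝ, 0 ≤ b ∧ w = LLL.psi b) ∧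
        ∃ γ θ : ℝ, u = LLL.phaseRotation γ (LLL.spaceRotation θ w) := by
  rw [LLL.isGlobalMinimizer_half_iff]
  constructor
  · rintro ⟨p, q, β, hm, hQ, rfl⟩
    by_cases hp : p = 0
    · subst hp
      obtain ⟨γ, h⟩ := LLL.exists_phi0_of_profile hm hQ
      exact ⟨_, Or.inl rfl, γ, 0, h⟩
    · obtain ⟨b, hb, γ, θ, h⟩ := LLL.exists_psi_of_profile hp hm hQ
      -- The alternative `φ₁` is not needed here, since it is `ψ_0`.
      exact ⟨_, Or.inr (Or.inr ⟨b, hb, rfl⟩), γ, θ, h⟩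
  · rintro ⟨w, hw, γ, θ, rfl⟩
    have hpsi : ∀ b : ℝ, ∃ p q β : ℂ, LLL.mass (LLL.profile p q β) = 1 ∧
        LLL.magneticMomentum (LLL.profile p q β) = 0 ∧
        LLL.phaseRotation γ (LLL.spaceRotation θ (LLL.psi b)) = LLL.profile p q β := fun b =>
      ⟨_, _, _, (LLL.mass_and_momentum_psi b γ θ).1, (LLL.mass_and_momentum_psi b γ θ).2, LLL.psi_eq b γ θ⟩
    rcases hw with rfl | rfl | ⟨b, -, rfl⟩
    · exact ⟨_, _, _, (LLL.mass_and_momentum_phi0 γ).1, (LLL.mass_and_momentum_phi0 γ).2, LLL.phi0_eq γ θ⟩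
    · rw [LLL.phi1_eq_psi]
      exact hpsi 0
    · exact hpsi b
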